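/- **Setting.** Let $H_1,\dots,H_L$ be Hermitian operators on $n$ qubits, $H=\sum_{l=1}^L H_l$, $U(x)=e^{-ixH}$, and let $K=1$ or $K=2k$ with $k\ge 1$. Let $S_K$ be the $K$th-order Trotter formula: $S_1(x)=e^{-ixH_L}\cdots e^{-ixH_1}$, $S_2(x)=S_1(-x/2)^\dagger S_1(x/2)$, and for $k\ge 2$ $$S_{2k}(x)=S_{2k-2}(u_kx)^2\,S_{2k-2}((1-4u_k)x)\,S_{2k-2}(u_kx)^2,\qquad u_k=\frac1{4-4^{1/(2k-1)}} .$$ Expanding the recursion writes it as an ordered product of $\kappa$ stages, $$S_K(x)=\prod^{\leftarrow}_{(j,l)}e^{-ix\,a_{(j,l)}H_{\pi_j(l)}},\qquad 1\le j\le\kappa,\ 1\le l\le L,$$ where $\kappa=1$ for $K=1$ and $\kappa=2\cdot5^{k-1}$ for $K=2k$, the pairs $(j,l)$ are ordered lexicographically (larger pairs stand further to the left), $a_{(j,l)}$ is the length of the $j$th stage, and $\pi_j$ is alternately the identity and the reversal of $\{1,\dots,L\}$. Put $V_K(x)=U(x)S_K(x)^\dagger$, $J_K(x)=S_K(x)\big(\tfrac{d}{dx}S_K(x)^\dagger-iH\,S_K(x)^\dagger\big)$,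 and, with $\mathrm{ad}_AB=AB-BA$, $$\begin{aligned}C_s={}&i\sum_{(j,l)}\ \sum_{\sum_{(j',l')\succ(j,l)}m_{(j',l')}=s}\binom{s}{\{m_{(j',l')}\}}\Big(\prod^{\leftarrow}_{(j',l')\succ(j,l)}(-ia_{(j',l')}\mathrm{ad}_{H_{\pi_{j'}(l')}})^{m_{(j',l')}}\Big)(a_{(j,l)}H_{\pi_j(l)})\\&-i\sum_{\sum_{(j',l')}m_{(j',l')}=s}\binom{s}{\{m_{(j',l')}\}}\Big(\prod^{\leftarrow}_{(j',l')}(-ia_{(j',l')}\mathrm{ad}_{H_{\pi_{j'}(l')}})^{m_{(j',l')}}\Big)H ,\end{aligned}$$ $$\tilde V_K(x)=I+\sum_{s=K+1}^{2K+1}C_{s-1}\frac{x^s}{s!}.$$ A $(\mu,\varepsilon)$-LCU formula of an operator $V$ is an operator $\tilde V=\mu\sum_{i}p_iV_i$ (a finite sum) with $\mu>0$, a probability distribution $p$ with positive entries and unitaries $V_i$, such that $\|V-\tilde V\|\le\varepsilon$ in spectral norm. For a norm $\nu$ on operators put $$\alpha^{(s)}_{H,\nu}=\sum_{l=1}^L\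 \sum_{m_1+\dots+m_\Upsilon=s}\binom{s}{m_1,\dots,m_\Upsilon}\,\nu\big(\mathrm{ad}_{A_\Upsilon}^{m_\Upsilon}\cdots\mathrm{ad}_{A_1}^{m_1}H_l\big),$$ where $A_1,\dots,A_\Upsilon$ ($\Upsilon=\kappa L$) is the sequence of the $H_{\pi_j(l)}$ in increasing lexicographical order of $(j,l)$. Write $\alpha_H^{(s)}$ for $\nu$ the spectral norm, and $\alpha_{H,1}^{(s)}$ for $\nu=\|\cdot\|_1$ the $1$-norm. The statement holds for both meanings of the $1$-norm: (i) $\|V\|_1$ is the infimum of $\mu$ over all $(\mu,0)$-LCU formulas of $V$; (ii) $\|V\|_1=\sum_P|c_P|$ for the expansion $V=\sum_Pc_PP$ in Pauli strings. In either case let $\eta_\Sigma=\sum_{s=K+1}^{2K+1}\|C_{s-1}\|_1\frac{x^s}{s!}$. **Proposition.** For every $s\ge0$, $C_s=J_K^{(s)}(0)$. For every $x>0$, $\tilde V_K(x)$ is a $(\mu,\varepsilon)$-LCU formula of $V_K(x)$ with $$\mu=\sqrt{1+\eta_\Sigma^2}\ \le\ \sqrt{1+4\kappa^2\Big(\sum_{s=K}^{2K}\alpha_{H,1}^{(s)}\frac{x^{s+1}}{(s+1)!}\Big)^2},$$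 $$\varepsilon=\|V_K(x)-\tilde V_K(x)\|\ \le\ 4\kappa^2\alpha_H^{(K)}\sum_{s=K}^{2K}\alpha_H^{(s)}\frac{x^{s+K+2}}{s!\,(K+1)!\,(s+K+2)}+2\kappa\frac{x^{2K+2}}{(2K+2)!}\alpha_H^{(2K+1)} .$$ In case (ii), all the unitaries of the formula can be taken to be Pauli rotations $e^{\pm i\arctan(\eta_\Sigma)P}$ with $P$ a Pauli string. Explicitly, if $\eta_\Sigma\neq0$, then $$\tilde V_K(x)=\sqrt{1+\eta_\Sigma^2}\sum_{s=K+1}^{2K+1}\frac{\|C_{s-1}\|_1x^s/s!}{\eta_\Sigma}\sum_{P}\frac{|c_P(C_{s-1})|}{\|C_{s-1}\|_1}\,e^{i\arctan(\eta_\Sigma)\,\sigma_P(C_{s-1})P},$$ where $c_P(C)$ is the coefficient of $P$ in the Pauli expansion of $C$, $\sigma_P(C)=1$ if $\operatorname{Im}c_P(C)\ge0$ and $-1$ otherwise, and terms with $C_{s-1}=0$ are read as $0$. -/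

import Mathlib

open scoped Matrix Matrix.Norms.L2Operator

noncomputable section

namespace TrotterLCU

/-- Operators on `n` qubits, as matrices in the computational basis. The norm `‖V‖` on them is
the spectral norm (the scope `Matrix.Norms.L2Operator` is open). -/
abbrev Op (n : ℕ) : Type := Matrix (Fin n → Fin 2) (Fin n → Fin 2) ℂ

/-! ### Trotter formulas -/

/-- The real-time evolution `exp (-i x H)`. -/
def evolution {n : ℕ} (H : Op n) (x : ℝ) : Op n :=
  NormedSpace.exp ((-(Complex.I * (x : ℂ))) • H)

/-- `exp (-i x H_L) ⋯ exp (-i x H_1)` (the factor of the first summand is rightmost). -/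
def trotterOne {n L : ℕ} (h : Fin L → Op n) (x : ℝ) : Op n :=
  ((List.ofFn fun l => evolution (h l) x).reverse).prod

/-- The Suzuki parameter `u_k = 1 / (4 - 4 ^ (1 / (2k-1)))`, used for `k ≥ 2`. -/
def suzukiParam (k : ℕ) : ℝ := 1 / (4 - (4 : ℝ) ^ (1 / (2 * (k : ℝ) - 1)))

/-- The Suzuki formula `S_{2k}`: `S_0 = I`, `S_2(x) = S_1(-x/2)† S_1(x/2)` and
`S_{2k}(x) = S_{2k-2}(u_k x)^2 S_{2k-2}((1-4u_k) x) S_{2k-2}(u_k x)^2` for `k ≥ 2`. -/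
def suzuki {n L : ℕ} (h : Fin L → Op n) : ℕ → ℝ → Op n
  | 0, _ => 1
  | 1, x => (trotterOne h (-x / 2))ᴴ * trotterOne h (x / 2)
  | k + 2, x =>
      suzuki h (k + 1) (suzukiParam (k + 2) * x) ^ 2 *
        suzuki h (k + 1) ((1 - 4 * suzukiParam (k + 2)) * x) *
        suzuki h (k + 1) (suzukiParam (k + 2) * x) ^ 2

/-- The `K`th-order Trotter formula, meant for `K = 1` or `K` even. -/
def trotter {n L : ℕ} (K : ℕ) (h : Fin L → Op n) (x : ℝ) : Op n :=
  if K = 1 then trotterOne h x else suzuki h (K / 2) x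

/-- The Trotter remainder `V_K(x) = U(x) S_K(x)†`, where `U(x) = exp (-i x ∑ H_l)`. -/
def trotterRemainder {n L : ℕ} (K : ℕ) (h : Fin L → Op n) (x : ℝ) : Op n :=
  evolution (∑ l, h l) x * (trotter K h x)ᴴ

/-- `J_K(x) = S_K(x) (d/dx S_K(x)† - i H S_K(x)†)`. -/
def derivRemainder {n L : ℕ} (K : ℕ) (h : Fin L → Op n) (x : ℝ) : Op n :=
  trotter K h x *
    (deriv (fun y : ℝ => (trotter K h y)ᴴ) x
      - Complex.I • ((∑ l, h l) * (trotter K h x)ᴴ))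

/-! ### The stages of a Trotter formula

A stage is a pair `(a, b)`: its length `a`, and whether the summands are applied in the order
`1, …, L` (`b = true`) or in the reversed order (`b = false`). Stages are listed in the order in
which they are applied, that is, from right to left in the operator product. -/

/-- The stages of `S_{2k}`. -/
def suzukiStages : ℕ → List (ℝ × Bool)
  | 0 => []
  | 1 => [(1 / 2, true), (1 / 2, false)]
  | k + 2 =>
      let c := (suzukiStages (k + 1)).map fun p => (suzukiParam (k + 2) * p.1, p.2)
      let d := (suzukiStages (k + 1)).map fun p => ((1 - 4 * suzukiParam (k + 2)) * p.1, p.2)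
      c ++ c ++ d ++ c ++ c

/-- The stages of the `K`th-order Trotter formula. -/
def trotterStages (K : ℕ) : List (ℝ × Bool) :=
  if K = 1 then [(1, true)] else suzukiStages (K / 2)

/-- The number `κ` of stages: `1` for `K = 1` and `2 * 5 ^ (k - 1)` for `K = 2k`. -/
def stageCount (K : ℕ) : ℕ := if K = 1 then 1 else 2 * 5 ^ (K / 2 - 1)

/-- The `L` steps `(a, l)` of a stage, in the order in which they are applied. -/
def stageSteps (L : ℕ) (p : ℝ × Bool) : List (ℝ × Fin L) :=
  (if p.2 then List.finRange L else (List.finRange L).reverse).map fun l => (p.1, l)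

/-- All the steps `(a_{(j,l)}, π_j(l))` of the `K`th-order Trotter formula, in increasing
lexicographical order of the pairs `(j,l)`. -/
def trotterSteps (K L : ℕ) : List (ℝ × Fin L) :=
  (trotterStages K).flatMap (stageSteps L)

/-- The number `Υ` of pairs `γ = (j,l)`. -/
def stepCount (K L : ℕ) : ℕ := (trotterSteps K L).length

/-- The coefficient `a_γ = a_{(j,l)}`. -/
def stepCoeff (K L : ℕ) (γ : Fin (stepCount K L)) : ℝ := ((trotterSteps K L).get γ).1

/-- The summand `H_γ = H_{π_j(l)}`. -/
def stepOp {n L : ℕ} (K : ℕ) (h : Fin L → Op n) (γ : Fin (stepCount K L)) : Op n :=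
  h ((trotterSteps K L).get γ).2

/-- There are `κ` stages. -/
theorem length_trotterStages {K : ℕ} (hK : K = 1 ∨ (Even K ∧ 0 < K)) :
    (trotterStages K).length = stageCount K := by
  have key : ∀ k : ℕ, (suzukiStages (k + 1)).length = 2 * 5 ^ k := by
    intro k
    induction k with
    | zero => simp [suzukiStages]
    | succ k ih =>
      simp only [suzukiStages, List.length_append, List.length_map, ih]
      ring
  rcases hK with rfl | ⟨⟨m, rfl⟩, hpos⟩
  · simp [trotterStages, stageCount]
  · obtain ⟨k, rfl⟩ : ∃ k, m = k + 1 := ⟨m - 1, by omega⟩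
    have h1 : ¬ (k + 1 + (k + 1) = 1) := by omega
    have h2 : (k + 1 + (k + 1)) / 2 = k + 1 := by omega
    simp [trotterStages, stageCount, h1, h2, key]

/-- There are `κ L` pairs `(j,l)`. -/
theorem stepCount_eq {K : ℕ} (L : ℕ) (hK : K = 1 ∨ (Even K ∧ 0 < K)) :
    stepCount K L = stageCount K * L := by
  have key : ∀ S : List (ℝ × Bool), (S.flatMap (stageSteps L)).length = S.length * L := by
    intro S
    induction S with
    | nil => simp
    | cons p S ih =>
      rw [List.flatMap_cons, List.length_append, ih]
      simp only [stageSteps, List.length_map, List.length_cons]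
      split_ifs <;> simp <;> ring
  rw [stepCount, trotterSteps, key, length_trotterStages hK]

/-- The product of the exponentials of a list of steps, the first step being rightmost. -/
def stepsProd {n L : ℕ} (h : Fin L → Op n) (T : List (ℝ × Fin L)) (x : ℝ) : Op n :=
  ((T.map fun p => evolution (h p.2) (x * p.1)).reverse).prod

theorem stepsProd_append {n L : ℕ} (h : Fin L → Op n) (T T' : List (ℝ × Fin L)) (x : ℝ) :
    stepsProd h (T ++ T') x = stepsProd h T' x * stepsProd h T x := by
  simp [stepsProd]

theorem evolution_conjTranspose {n : ℕ} {H : Op n} (hH : H.IsHermitian) (x : ℝ) :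
    (evolution H x)ᴴ = evolution H (-x) := by
  unfold evolution
  rw [← Matrix.exp_conjTranspose, Matrix.conjTranspose_smul, hH.eq]
  simp

/-- The recursively defined Trotter formula is the ordered product over its steps, the first
step being rightmost. -/
theorem trotter_eq_stepsProd {n L : ℕ} (K : ℕ) (h : Fin L → Op n)
    (hh : ∀ l, (h l).IsHermitian) (x : ℝ) :
    trotter K h x = stepsProd h (trotterSteps K L) x := by
  have scale : ∀ (S : List (ℝ × Bool)) (u y : ℝ),
      stepsProd h ((S.map fun p => (u * p.1, p.2)).flatMap (stageSteps L)) y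
        = stepsProd h (S.flatMap (stageSteps L)) (u * y) := by
    intro S u y
    induction S with
    | nil => simp [stepsProd]
    | cons p S ih =>
      rw [List.map_cons, List.flatMap_cons, List.flatMap_cons, stepsProd_append,
        stepsProd_append, ih]
      congr 1
      simp only [stepsProd, stageSteps, List.map_map, Function.comp_def]
      congr 4
      funext l
      congr 1
      ring
  have one : ∀ (a y : ℝ), stepsProd h (stageSteps L (a, true)) y = trotterOne h (y * a) := by
    intro a y
    simp [stepsProd, stageSteps, trotterOne, List.map_map, Function.comp_def, List.ofFn_eq_map]
  have two : ∀ (a y : ℝ),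
      stepsProd h (stageSteps L (a, false)) y = (trotterOne h (-(y * a)))ᴴ := by
    intro a y
    simp [stepsProd, stageSteps, trotterOne, List.map_map, Function.comp_def, List.ofFn_eq_map,
      Matrix.conjTranspose_list_prod, evolution_conjTranspose (hh _)]
  have main : ∀ k y, suzuki h k y = stepsProd h ((suzukiStages k).flatMap (stageSteps L)) y := by
    intro k
    induction k with
    | zero => intro y; simp [suzuki, suzukiStages, stepsProd]
    | succ k ih =>
      intro y
      cases k with
      | zero =>
        simp only [suzuki, suzukiStages, List.flatMap_cons, List.flatMap_nil, List.append_nil,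
          stepsProd_append, one, two]
        congr 3 <;> ring
      | succ k =>
        simp only [suzuki, suzukiStages, List.flatMap_append, stepsProd_append, scale, ← ih]
        noncomm_ring
  unfold trotter trotterSteps trotterStages
  split_ifs with hK
  · simp [List.flatMap_cons, one]
  · exact main _ _

/-! ### Nested commutators -/

/-- The ordered composition `T_N ^ m_N ∘ ⋯ ∘ T_1 ^ m_1` (the last index is leftmost). -/
def orderedPow {n N : ℕ} (T : Fin N → Module.End ℂ (Op n)) (m : Fin N → ℕ) :
    Module.End ℂ (Op n) :=
  ((List.ofFn fun γ => T γ ^ m γ).reverse).prod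

/-- `ad_A B = A B - B A`. -/
def adj {n : ℕ} (A : Op n) : Module.End ℂ (Op n) :=
  LinearMap.mulLeft ℂ A - LinearMap.mulRight ℂ A

/-- `α_com^{(s)}(A_N, …, A_1; B)
  = ∑_{m_1 + ⋯ + m_N = s} (s choose m_1, …, m_N) ν(ad_{A_N}^{m_N} ⋯ ad_{A_1}^{m_1} B)`
for a matrix norm `ν`. -/
def alphaCom {n N : ℕ} (ν : Op n → ℝ) (s : ℕ) (A : Fin N → Op n) (B : Op n) : ℝ :=
  ∑ m ∈ Finset.piAntidiag (Finset.univ : Finset (Fin N)) s,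
    (Nat.multinomial Finset.univ m : ℝ) * ν (orderedPow (fun γ => adj (A γ)) m B)

/-- The nested commutator norm `α_H^{(s)}` of the `K`th-order Trotter formula with respect to the
matrix norm `ν`. -/
def alphaH {n L : ℕ} (ν : Op n → ℝ) (K : ℕ) (h : Fin L → Op n) (s : ℕ) : ℝ :=
  ∑ l, alphaCom ν s (stepOp K h) (h l)

/-- The coefficient `C_s` in nested-commutator form. In the first sum, `m` ranges over the
exponents that are supported on the `γ' > γ` and sum to `s`. -/
def compCoeff {n L : ℕ} (K : ℕ) (h : Fin L → Op n) (s : ℕ) : Op n :=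
  Complex.I • (∑ γ : Fin (stepCount K L), ∑ m ∈ Finset.piAntidiag (Finset.Ioi γ) s,
      (Nat.multinomial (Finset.Ioi γ) m : ℂ) •
        orderedPow (fun γ' => (-(Complex.I * (stepCoeff K L γ' : ℂ))) • adj (stepOp K h γ')) m
          ((stepCoeff K L γ : ℂ) • stepOp K h γ))
  - Complex.I • (∑ m ∈ Finset.piAntidiag (Finset.univ : Finset (Fin (stepCount K L))) s,
      (Nat.multinomial Finset.univ m : ℂ) •
        orderedPow (fun γ' => (-(Complex.I * (stepCoeff K L γ' : ℂ))) • adj (stepOp K h γ')) m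
          (∑ l, h l))

/-- The nested-commutator compensation `Ṽ_K(x) = I + ∑_{s=K+1}^{2K+1} C_{s-1} x^s / s!`. -/
def compensation {n L : ℕ} (K : ℕ) (h : Fin L → Op n) (x : ℝ) : Op n :=
  1 + ∑ s ∈ Finset.Icc (K + 1) (2 * K + 1),
    ((x ^ s / (s.factorial : ℝ) : ℝ) : ℂ) • compCoeff K h (s - 1)

/-! ### Linear combinations of unitaries -/

/-- `W` is a `(μ, ε)`-LCU formula of `V` whose elementary unitaries belong to the set `E`:
`W = μ ∑_i p_i U_i` with a probability distribution `p` with positive entries and unitaries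
`U_i ∈ E`, and `‖V - W‖ ≤ ε` in spectral norm. -/
def IsLCUFormulaOver {n : ℕ} (E : Set (Op n)) (V W : Op n) (μ ε : ℝ) : Prop :=
  0 < μ ∧ ‖V - W‖ ≤ ε ∧
    ∃ (Γ : ℕ) (p : Fin Γ → ℝ) (U : Fin Γ → Op n),
      (∀ i, 0 < p i) ∧ ∑ i, p i = 1 ∧
      (∀ i, U i ∈ Matrix.unitaryGroup (Fin n → Fin 2) ℂ) ∧ (∀ i, U i ∈ E) ∧
      W = (μ : ℂ) • ∑ i, (p i : ℂ) • U i

/-- `W` is a `(μ, ε)`-LCU formula of `V`, with arbitrary elementary unitaries. -/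
def IsLCUFormula {n : ℕ} (V W : Op n) (μ ε : ℝ) : Prop :=
  IsLCUFormulaOver Set.univ V W μ ε

/-- The `1`-norm of `V`: the infimum of the `μ` over all `(μ, 0)`-LCU formulas of `V`. -/
def oneNorm {n : ℕ} (V : Op n) : ℝ := sInf {μ : ℝ | IsLCUFormula V V μ 0}

/-- `η_Σ = ∑_{s=K+1}^{2K+1} ν(C_{s-1}) x^s / s!` for a matrix norm `ν`. -/
def etaSum {n L : ℕ} (ν : Op n → ℝ) (K : ℕ) (h : Fin L → Op n) (x : ℝ) : ℝ :=
  ∑ s ∈ Finset.Icc (K + 1) (2 * K + 1), ν (compCoeff K h (s - 1)) * (x ^ s / (s.factorial : ℝ))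

/-! ### Pauli operators -/

/-- The matrices `I`, `X`, `Y`, `Z`. -/
def pauli : Fin 4 → Matrix (Fin 2) (Fin 2) ℂ :=
  ![1, !![0, 1; 1, 0], !![0, -Complex.I; Complex.I, 0], !![1, 0; 0, -1]]

/-- The tensor product of the one-qubit Pauli matrices `σ_1, …, σ_n`. -/
def pauliString {n : ℕ} (σ : Fin n → Fin 4) : Op n :=
  Matrix.of fun a b => ∏ i, pauli (σ i) (a i) (b i)

/-- The coefficient of `P_σ` in the Pauli expansion of `V`. -/
def pauliCoeff {n : ℕ} (V : Op n) (σ : Fin n → Fin 4) : ℂ :=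
  (pauliString σ * V).trace / (2 : ℂ) ^ n

/-- The `1`-norm of the Pauli expansion of `V`. -/
def pauliNorm {n : ℕ} (V : Op n) : ℝ := ∑ σ, ‖pauliCoeff V σ‖

/-- The Pauli rotations `exp (i θ P)` and `exp (-i θ P)` of angle `θ`, with `P` a Pauli string. -/
def pauliRotations (n : ℕ) (θ : ℝ) : Set (Op n) :=
  {U | ∃ (σ : Fin n → Fin 4) (ε : ℝ), (ε = 1 ∨ ε = -1) ∧
    U = NormedSpace.exp ((Complex.I * (θ : ℂ)) • ((ε : ℂ) • pauliString σ))}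

/-- For an anti-Hermitian `C = i ‖C‖₁ ∑_σ Pr(σ) P'_σ`, with `P'_σ = ± P_σ` and `‖C‖₁` the Pauli
`1`-norm, the operator `P'_σ`. -/
def signedPauli {n : ℕ} (C : Op n) (σ : Fin n → Fin 4) : Op n :=
  if 0 ≤ (pauliCoeff C σ).im then pauliString σ else -pauliString σ

/-- For an anti-Hermitian `C = i ‖C‖₁ ∑_σ Pr(σ) P'_σ` as above, the mixture
`∑_σ Pr(σ) exp (i arctan(η) P'_σ)` of Pauli rotations. -/
def rotationMixture {n : ℕ} (C : Op n) (η : ℝ) : Op n :=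
  ∑ σ, ((‖pauliCoeff C σ‖ / pauliNorm C : ℝ) : ℂ) •
    NormedSpace.exp ((Complex.I * (Real.arctan η : ℂ)) • signedPauli C σ)

end TrotterLCU

end

open TrotterLCU

/-!
Conjugation by `exp (x X)` is `exp (x ad X)`, so `J_K` is a sum of ordered products of exponentials
of commutators applied to the generators, and `C_s` is the multinomial expansion of its `s`th Taylor
coefficient. The same expansion bounds the Taylor remainder of `J_K`, because each `exp (x ad X)`
with `X` anti-Hermitian is an isometry.

Suzuki's parameter cancels the leading error of the symmetric formula of the previous order, and a
symmetric formula has no error of even order, so `S_K - U = O (x ^ (K + 1))`. Since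
`J_K = ((S_K - U) Y - (S_K - U)') S_K†` with `Y = -i H`, the coefficients `C_s` with `s < K` vanish.
As `V_K' = V_K J_K` with `V_K` unitary, integrating once gives `V_K - 1 = O (x ^ (K + 1))`, and
integrating `V_K J_K - T = (V_K - 1) T + V_K (J_K - T)`, where `T` is the Taylor polynomial of
`J_K`, gives the error bound.

The compensation is `1 + X` with `X` anti-Hermitian, hence normal of norm at most `√(1 + η²)` as
soon as `‖X‖ ≤ η`, and a normal contraction is the midpoint of two unitaries. For Pauli rotations,
`√(1 + η²) exp (i arctan(η) P) = 1 + i η P` pairs the identity with the Pauli strings of `X`.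
-/

noncomputable section

namespace TrotterLCU

open scoped ContDiff

section Multinomial

open Finset

theorem sum_piAntidiag_univ_succ {M : Type*} [AddCommMonoid M] {N : ℕ} (s : ℕ)
    (f : (Fin (N + 1) → ℕ) → M) :
    ∑ m ∈ piAntidiag univ s, f m =
      ∑ q ∈ antidiagonal s, ∑ m ∈ piAntidiag univ q.2, f (Fin.cons q.1 m) := by
  simp only [piAntidiag_univ_fin_eq_antidiagonalTuple]
  change (List.map f (List.Nat.antidiagonalTuple (N + 1) s)).sum =
    (List.map _ (List.Nat.antidiagonal s)).sum
  rw [List.Nat.antidiagonalTuple, List.map_flatMap, List.flatMap_def, List.sum_flatten,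
    List.map_map]
  simp only [Function.comp_def, List.map_map]
  rfl

theorem multinomial_cons {N : ℕ} (i : ℕ) (m : Fin N → ℕ) :
    Nat.multinomial univ (Fin.cons i m : Fin (N + 1) → ℕ) =
      (i + ∑ k, m k).choose i * Nat.multinomial univ m := by
  rw [Fin.univ_succ, Nat.multinomial_cons, Fin.cons_zero, sum_map]
  congr 1
  simp [Nat.multinomial]

theorem sum_multinomial_nsmul_succ {M : Type*} [AddCommMonoid M] {N : ℕ} (s : ℕ)
    (f : (Fin (N + 1) → ℕ) → M) :
    ∑ m ∈ piAntidiag univ s, Nat.multinomial univ m • f m =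
      ∑ q ∈ antidiagonal s, s.choose q.1 •
        ∑ m ∈ piAntidiag univ q.2, Nat.multinomial univ m • f (Fin.cons q.1 m) := by
  rw [sum_piAntidiag_univ_succ]
  refine sum_congr rfl fun q hq => ?_
  rw [smul_sum]
  refine sum_congr rfl fun m hm => ?_
  rw [multinomial_cons, (mem_piAntidiag.1 hm).1, mem_antidiagonal.1 hq, mul_smul]

/-- The product `f (N - 1) * ⋯ * f 0`: factors applied first stand to the right. -/
def revProd {M : Type*} [Monoid M] {N : ℕ} (f : Fin N → M) : M :=
  (List.ofFn f).reverse.prod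

section RevProd

variable {M : Type*} [Monoid M] {N : ℕ}

@[simp]
theorem revProd_zero (f : Fin 0 → M) : revProd f = 1 := by
  simp [revProd]

theorem revProd_succ (f : Fin (N + 1) → M) : revProd f = revProd (fun i => f i.succ) * f 0 := by
  simp [revProd, List.ofFn_succ]

theorem revProd_mem {S : Type*} [SetLike S M] [SubmonoidClass S M] {U : S} {f : Fin N → M}
    (hf : ∀ i, f i ∈ U) : revProd f ∈ U :=
  list_prod_mem (by simpa [List.forall_mem_ofFn_iff] using hf)

end RevProd

/-- The sum of `(s choose m) • ν (T_N ^ m_N ⋯ T_1 ^ m_1 G)` over all exponents `m` of total degree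
`s`. For `ν = id` it is the multinomial expansion of a Taylor coefficient of a product of
exponentials, for a norm `ν` its termwise bound. -/
def multinomialSum {M E F : Type*} [Monoid M] [MulAction M E] [AddCommMonoid F] {N : ℕ}
    (ν : E → F) (T : Fin N → M) (s : ℕ) (G : E) : F :=
  ∑ m ∈ piAntidiag univ s, Nat.multinomial univ m • ν (revProd (fun i => T i ^ m i) • G)

section MultinomialSum

variable {M M' E F : Type*} [Monoid M] [MulAction M E] [Monoid M'] [MulAction M' E]
  [AddCommMonoid F] {N : ℕ}

theorem multinomialSum_degree_zero (ν : E → F) (T : Fin N → M) (G : E) :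
    multinomialSum ν T 0 G = ν G := by
  have : revProd (fun _ : Fin N => (1 : M)) = 1 := by simp [revProd]
  simp [multinomialSum, Nat.multinomial, this]

theorem multinomialSum_of_isEmpty (ν : E → F) (T : Fin 0 → M) {s : ℕ} (hs : s ≠ 0) (G : E) :
    multinomialSum ν T s G = 0 := by
  simp [multinomialSum, piAntidiag_empty_of_ne_zero hs]

theorem multinomialSum_succ (ν : E → F) (T : Fin (N + 1) → M) (s : ℕ) (G : E) :
    multinomialSum ν T s G = ∑ q ∈ antidiagonal s,
      s.choose q.1 • multinomialSum ν (fun i => T i.succ) q.2 (T 0 ^ q.1 • G) := by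
  rw [multinomialSum, sum_multinomial_nsmul_succ]
  simp only [revProd_succ, Fin.cons_succ, Fin.cons_zero, mul_smul]
  rfl

theorem multinomialSum_congr (ν : E → F) {T : Fin N → M} {T' : Fin N → M'}
    (hT : ∀ i (G : E), T i • G = T' i • G) (s : ℕ) (G : E) :
    multinomialSum ν T s G = multinomialSum ν T' s G := by
  induction N generalizing s G with
  | zero =>
    rcases eq_or_ne s 0 with rfl | hs
    · simp only [multinomialSum_degree_zero]
    · simp only [multinomialSum_of_isEmpty _ _ hs]
  | succ N ih =>
    have hpow : ∀ k : ℕ, T 0 ^ k • G = T' 0 ^ k • G := fun k => by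
      induction k with
      | zero => simp
      | succ k ihk => rw [pow_succ', pow_succ', mul_smul, mul_smul, ihk, hT]
    simp only [multinomialSum_succ, hpow, ih fun i => hT i.succ]

theorem multinomialSum_smul {R : Type*} [SMul R E] [SMulCommClass M R E] [DistribSMul R F]
    {ν : E → F} {r : R} (hν : ∀ G, ν (r • G) = r • ν G) (T : Fin N → M) (s : ℕ) (G : E) :
    multinomialSum ν T s (r • G) = r • multinomialSum ν T s G := by
  simp only [multinomialSum, smul_comm _ r G, hν, smul_sum]
  exact sum_congr rfl fun m _ => smul_comm _ _ _

end MultinomialSum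

theorem multinomialSum_mem {M E S : Type*} [Monoid M] [AddCommMonoid E] [MulAction M E]
    [SetLike S E] [AddSubmonoidClass S E] {N : ℕ} {A : S} {T : Fin N → M}
    (hT : ∀ i, ∀ G ∈ A, T i • G ∈ A) {s : ℕ} {G : E} (hG : G ∈ A) :
    multinomialSum id T s G ∈ A := by
  induction N generalizing s G with
  | zero =>
    rcases eq_or_ne s 0 with rfl | hs
    · rwa [multinomialSum_degree_zero]
    · rw [multinomialSum_of_isEmpty _ _ hs]
      exact zero_mem A
  | succ N ih =>
    have hpow : ∀ k : ℕ, T 0 ^ k • G ∈ A := fun k => by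
      induction k with
      | zero => simpa using hG
      | succ k ihk => rw [pow_succ', mul_smul]; exact hT 0 _ ihk
    rw [multinomialSum_succ]
    exact sum_mem fun q _ => nsmul_mem (ih (fun i => hT i.succ) (hpow q.1)) _

theorem piAntidiag_eq_filter_univ {N : ℕ} (I : Finset (Fin N)) (s : ℕ) :
    piAntidiag I s = (piAntidiag univ s).filter fun m => ∀ i, m i ≠ 0 → i ∈ I := by
  ext m
  simp only [mem_filter, mem_piAntidiag, mem_univ, implies_true, and_true]
  refine and_congr_left fun hI => ?_
  rw [sum_subset (subset_univ I) fun i _ hi => by_contra fun h => hi (hI i h)]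

theorem multinomial_eq_of_support_subset {ι : Type*} {I J : Finset ι} {m : ι → ℕ} (hIJ : I ⊆ J)
    (hm : ∀ i, m i ≠ 0 → i ∈ I) : Nat.multinomial I m = Nat.multinomial J m := by
  have h0 : ∀ i ∉ I, m i = 0 := fun i hi => by_contra fun h => hi (hm i h)
  rw [Nat.multinomial, Nat.multinomial, sum_subset hIJ fun i _ hi => h0 i hi,
    prod_subset hIJ fun i _ hi => by rw [h0 i hi, Nat.factorial_zero]]

theorem sum_multinomial_piAntidiag_eq_multinomialSum {M E F : Type*} [MonoidWithZero M]
    [Zero E] [MulActionWithZero M E] [AddCommMonoid F] {N : ℕ} {ν : E → F} (hν : ν 0 = 0)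
    (T : Fin N → M) (I : Finset (Fin N)) (s : ℕ) (G : E) :
    ∑ m ∈ piAntidiag I s, Nat.multinomial I m • ν (revProd (fun i => T i ^ m i) • G) =
      multinomialSum ν (fun i => if i ∈ I then T i else 0) s G := by
  rw [multinomialSum, piAntidiag_eq_filter_univ I, sum_filter]
  refine sum_congr rfl fun m _ => ?_
  split_ifs with hI
  · rw [multinomial_eq_of_support_subset (subset_univ I) hI]
    congr 4
    funext i
    by_cases hi : i ∈ I
    · rw [if_pos hi]
    · rw [if_neg hi, by_contra fun h => hi (hI i h), pow_zero, pow_zero]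
  · push Not at hI
    obtain ⟨i, hi, hiI⟩ := hI
    have hzero : revProd (fun i => (if i ∈ I then T i else 0) ^ m i) = 0 :=
      List.prod_eq_zero (List.mem_reverse.2 (List.mem_ofFn.2 ⟨i, by simp [hi, hiI]⟩))
    rw [hzero, zero_smul, hν, smul_zero]

end Multinomial

section TaylorHelpers

theorem hasDerivAt_pow_div_factorial (p : ℕ) (x : ℝ) :
    HasDerivAt (fun y : ℝ => y ^ (p + 1) / ((p + 1).factorial : ℝ))
      (x ^ p / (p.factorial : ℝ)) x := by
  refine ((hasDerivAt_pow (p + 1) x).div_const ((p + 1).factorial : ℝ)).congr_deriv ?_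
  rw [Nat.factorial_succ]
  push_cast
  field_simp

theorem hasDerivAt_pow_div_factorial_mul_factorial (s p : ℕ) (x : ℝ) :
    HasDerivAt
      (fun y : ℝ => y ^ (s + p + 2) /
        ((s.factorial : ℝ) * ((p + 1).factorial : ℝ) * ((s + p + 2 : ℕ) : ℝ)))
      (x ^ s / (s.factorial : ℝ) * (x ^ (p + 1) / ((p + 1).factorial : ℝ))) x := by
  refine ((hasDerivAt_pow (s + p + 2) x).div_const _).congr_deriv ?_
  rw [show s + p + 2 - 1 = s + (p + 1) by omega, pow_add]
  field_simp

theorem pow_div_factorial_mul_choose (x : ℝ) {s i j : ℕ} (h : i + j = s) :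
    x ^ s / (s.factorial : ℝ) * (s.choose i : ℝ) =
      x ^ i / (i.factorial : ℝ) * (x ^ j / (j.factorial : ℝ)) := by
  subst h
  rw [Nat.cast_add_choose, pow_add]
  field_simp

theorem norm_le_of_norm_deriv_le_pow {E : Type*} [NormedAddCommGroup E] [NormedSpace ℝ E]
    {f f' : ℝ → E} (hf : ∀ y, HasDerivAt f (f' y) y) (h0 : f 0 = 0) {p : ℕ} {c : ℝ}
    (hf' : ∀ y, 0 ≤ y → ‖f' y‖ ≤ y ^ p / (p.factorial : ℝ) * c) {x : ℝ} (hx : 0 ≤ x) :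
    ‖f x‖ ≤ x ^ (p + 1) / ((p + 1).factorial : ℝ) * c :=
  image_norm_le_of_norm_deriv_right_le_deriv_boundary
    (fun y _ => (hf y).continuousAt.continuousWithinAt) (fun y _ => (hf y).hasDerivWithinAt)
    (by simp [h0]) (fun y => (hasDerivAt_pow_div_factorial p y).mul_const c)
    (fun y hy => hf' y hy.1) ⟨hx, le_rfl⟩

theorem contDiff_deriv {E : Type*} [NormedAddCommGroup E] [NormedSpace ℝ E] {f : ℝ → E}
    (h : ContDiff ℝ ∞ f) : ContDiff ℝ ∞ (deriv f) :=
  (contDiff_infty_iff_deriv.1 h).2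

theorem iteratedDeriv_mul_eq_sum_antidiagonal {𝔸 : Type*} [NormedRing 𝔸] [NormedAlgebra ℝ 𝔸]
    {f g : ℝ → 𝔸} (hf : ContDiff ℝ ∞ f) (hg : ContDiff ℝ ∞ g) (s : ℕ) (x : ℝ) :
    iteratedDeriv s (fun y => f y * g y) x =
      ∑ q ∈ Finset.HasAntidiagonal.antidiagonal s,
        s.choose q.1 • (iteratedDeriv q.1 f x * iteratedDeriv q.2 g x) := by
  have hle : (s : WithTop ℕ∞) ≤ ∞ := mod_cast le_top
  change iteratedDeriv s (f * g) x = _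
  rw [iteratedDeriv_mul (hf.of_le hle).contDiffAt (hg.of_le hle).contDiffAt,
    Finset.Nat.sum_antidiagonal_eq_sum_range_succ
      fun i j => s.choose i • (iteratedDeriv i f x * iteratedDeriv j g x)]
  simp only [nsmul_eq_mul, mul_assoc]

theorem iteratedDeriv_clm_apply {E F : Type*} [NormedAddCommGroup E] [NormedSpace ℝ E]
    [NormedAddCommGroup F] [NormedSpace ℝ F] (B : E →L[ℝ] F) {f : ℝ → E} (hf : ContDiff ℝ ∞ f)
    (s : ℕ) (x : ℝ) : iteratedDeriv s (fun y => B (f y)) x = B (iteratedDeriv s f x) := by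
  induction s generalizing f with
  | zero => simp
  | succ s ih =>
    have hB : deriv (fun y => B (f y)) = fun y => B (deriv f y) := funext fun y =>
      (B.hasFDerivAt.comp_hasDerivAt y (hf.differentiable (by simp) y).hasDerivAt).deriv
    rw [iteratedDeriv_succ', iteratedDeriv_succ', hB, ih (contDiff_deriv hf)]

end TaylorHelpers

/-- The ordered product `exp (x X_{N-1}) ⋯ exp (x X_0)` of one-parameter groups. -/
def expProd {𝔸 : Type*} [NormedRing 𝔸] [NormedAlgebra ℝ 𝔸] {N : ℕ} (X : Fin N → 𝔸) (x : ℝ) : 𝔸 :=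
  revProd fun i => NormedSpace.exp (x • X i)

section ExpProd

variable {𝔸 : Type*} [NormedRing 𝔸] [NormedAlgebra ℝ 𝔸] {N : ℕ}

@[simp]
theorem expProd_of_isEmpty (X : Fin 0 → 𝔸) (x : ℝ) : expProd X x = 1 :=
  revProd_zero _

theorem expProd_succ (X : Fin (N + 1) → 𝔸) (x : ℝ) :
    expProd X x = expProd (fun i => X i.succ) x * NormedSpace.exp (x • X 0) :=
  revProd_succ _

theorem expProd_apply_zero (X : Fin N → 𝔸) : expProd X 0 = 1 := by
  induction N with
  | zero => simp
  | succ N ih => simp [expProd_succ, ih]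

variable [CompleteSpace 𝔸]

theorem contDiff_exp_smul (X : 𝔸) : ContDiff ℝ ∞ fun x : ℝ => NormedSpace.exp (x • X) :=
  contDiff_iff_contDiffAt.2 fun x =>
    ((NormedSpace.exp_analytic (𝕂 := ℝ) (x • X)).contDiffAt).comp x
      (contDiff_id.smul contDiff_const).contDiffAt

theorem contDiff_expProd (X : Fin N → 𝔸) : ContDiff ℝ ∞ (expProd X) := by
  induction N with
  | zero => simpa only [funext (expProd_of_isEmpty X)] using contDiff_const
  | succ N ih => simpa only [funext (expProd_succ X)] using (ih _).mul (contDiff_exp_smul _)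

theorem iteratedDeriv_exp_smul (X : 𝔸) (s : ℕ) :
    iteratedDeriv s (fun x : ℝ => NormedSpace.exp (x • X)) =
      fun x => NormedSpace.exp (x • X) * X ^ s := by
  induction s with
  | zero => simp
  | succ s ih =>
    funext x
    rw [iteratedDeriv_succ, ih, ((hasDerivAt_exp_smul_const X x).mul_const _).deriv, mul_assoc,
      pow_succ']

end ExpProd

section ExpProdApply

open Finset

variable {E : Type*} [NormedAddCommGroup E] [NormedSpace ℝ E] {N : ℕ}

theorem iteratedDeriv_apply {Φ : ℝ → E →L[ℝ] E} (hΦ : ContDiff ℝ ∞ Φ) (G : E) (s : ℕ) (x : ℝ) :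
    iteratedDeriv s (fun y => Φ y G) x = iteratedDeriv s Φ x G :=
  iteratedDeriv_clm_apply (ContinuousLinearMap.apply ℝ E G) hΦ s x

theorem norm_expProd_apply {B : Fin N → E →L[ℝ] E}
    (hB : ∀ i (x : ℝ) G, ‖NormedSpace.exp (x • B i) G‖ = ‖G‖) (x : ℝ) (G : E) :
    ‖expProd B x G‖ = ‖G‖ := by
  induction N generalizing G with
  | zero => simp
  | succ N ih =>
    rw [expProd_succ, mul_apply_eq_comp, ih fun i => hB i.succ, hB]

theorem sum_range_taylor_antidiagonal (x : ℝ) (p : ℕ) (f : ℕ → ℕ → E) :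
    ∑ s ∈ range p, (x ^ s / (s.factorial : ℝ)) • ∑ q ∈ antidiagonal s, s.choose q.1 • f q.1 q.2 =
      ∑ j ∈ range p, (x ^ j / (j.factorial : ℝ)) •
        ∑ k ∈ range (p - j), (x ^ k / (k.factorial : ℝ)) • f j k := by
  simp only [smul_sum]
  rw [← sum_range_diag_flip]
  refine sum_congr rfl fun s _ => ?_
  rw [Nat.sum_antidiagonal_eq_sum_range_succ
    fun i j => (x ^ s / (s.factorial : ℝ)) • s.choose i • f i j]
  refine sum_congr rfl fun i hi => ?_
  have his : i + (s - i) = s := Nat.add_sub_of_le (Nat.lt_succ_iff.1 (mem_range.1 hi))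
  rw [← Nat.cast_smul_eq_nsmul ℝ, smul_smul, pow_div_factorial_mul_choose x his, mul_smul]

theorem taylor_multinomialSum_succ (B : Fin (N + 1) → E →L[ℝ] E) (p : ℕ) (G : E) (x : ℝ) :
    ∑ s ∈ range p, (x ^ s / (s.factorial : ℝ)) • multinomialSum id B s G =
      ∑ j ∈ range p, (x ^ j / (j.factorial : ℝ)) • ∑ k ∈ range (p - j),
        (x ^ k / (k.factorial : ℝ)) • multinomialSum id (fun i => B i.succ) k ((B 0 ^ j) G) := by
  simp only [multinomialSum_succ]
  exact sum_range_taylor_antidiagonal x p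
    fun j k => multinomialSum id (fun i => B i.succ) k ((B 0 ^ j) G)

theorem multinomialSum_norm_succ (B : Fin (N + 1) → E →L[ℝ] E) (p : ℕ) (G : E) (x : ℝ) :
    x ^ p / (p.factorial : ℝ) * multinomialSum norm B p G =
      x ^ p / (p.factorial : ℝ) * ‖(B 0 ^ p) G‖ + ∑ j ∈ range p, x ^ j / (j.factorial : ℝ) *
        (x ^ (p - j) / ((p - j).factorial : ℝ) *
          multinomialSum norm (fun i => B i.succ) (p - j) ((B 0 ^ j) G)) := by
  rw [multinomialSum_succ, Nat.sum_antidiagonal_eq_sum_range_succ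
    fun i j => p.choose i • multinomialSum norm (fun i => B i.succ) j (B 0 ^ i • G),
    sum_range_succ, mul_add, add_comm, mul_sum]
  congr 1
  · simp [multinomialSum_degree_zero]
  · refine sum_congr rfl fun j hj => ?_
    have hjp : j + (p - j) = p := Nat.add_sub_of_le (mem_range.1 hj).le
    rw [nsmul_eq_mul, ← mul_assoc, ← mul_assoc, pow_div_factorial_mul_choose x hjp]
    rfl

variable [CompleteSpace E]

theorem contDiff_expProd_apply (B : Fin N → E →L[ℝ] E) (G : E) :
    ContDiff ℝ ∞ fun x => expProd B x G :=
  (contDiff_expProd B).clm_apply contDiff_const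

theorem iteratedDeriv_expProd_apply (B : Fin N → E →L[ℝ] E) (s : ℕ) (G : E) :
    iteratedDeriv s (fun x => expProd B x G) 0 = multinomialSum id B s G := by
  induction N generalizing s G with
  | zero =>
    rcases eq_or_ne s 0 with rfl | hs
    · simp [multinomialSum_degree_zero]
    · simp [multinomialSum_of_isEmpty _ _ hs, iteratedDeriv_const, hs]
  | succ N ih =>
    have hexp : ∀ j, iteratedDeriv j (fun x : ℝ => NormedSpace.exp (x • B 0)) 0 = B 0 ^ j :=
      fun j => (congrFun (iteratedDeriv_exp_smul (B 0) j) 0).trans (by simp)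
    rw [iteratedDeriv_apply (contDiff_expProd B), funext (expProd_succ B),
      iteratedDeriv_mul_eq_sum_antidiagonal (contDiff_expProd _) (contDiff_exp_smul _),
      multinomialSum_succ, ← Nat.sum_antidiagonal_swap, _root_.sum_apply]
    refine sum_congr rfl fun q hq => ?_
    rw [← ih, iteratedDeriv_apply (contDiff_expProd _), Prod.fst_swap, Prod.snd_swap, hexp,
      Nat.choose_symm_of_eq_add (mem_antidiagonal.1 hq).symm]
    rfl

theorem norm_exp_smul_apply_sub_taylor_le {B : E →L[ℝ] E}
    (hB : ∀ (x : ℝ) G, ‖NormedSpace.exp (x • B) G‖ = ‖G‖) (p : ℕ) (G : E) {x : ℝ} (hx : 0 ≤ x) :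
    ‖NormedSpace.exp (x • B) G - ∑ j ∈ range p, (x ^ j / (j.factorial : ℝ)) • (B ^ j) G‖ ≤
      x ^ p / (p.factorial : ℝ) * ‖(B ^ p) G‖ := by
  induction p generalizing G x with
  | zero => simp [hB]
  | succ p ih =>
    refine norm_le_of_norm_deriv_le_pow
      (f := fun y => NormedSpace.exp (y • B) G -
        ∑ j ∈ range (p + 1), (y ^ j / (j.factorial : ℝ)) • (B ^ j) G)
      (f' := fun y => NormedSpace.exp (y • B) (B G) -
        ∑ j ∈ range p, (y ^ j / (j.factorial : ℝ)) • (B ^ j) (B G))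
      (fun y => ?_) ?_ (fun y hy => ?_) hx
    · have hexp : HasDerivAt (fun y : ℝ => NormedSpace.exp (y • B) G)
          (NormedSpace.exp (y • B) (B G)) y := by
        simpa using (hasDerivAt_exp_smul_const B y).clm_apply (hasDerivAt_const y G)
      simp only [sum_range_succ', pow_zero, Nat.factorial_zero, Nat.cast_one, div_one, one_smul,
        pow_succ B, mul_apply_eq_comp]
      exact hexp.sub ((HasDerivAt.fun_sum fun j _ =>
        (hasDerivAt_pow_div_factorial j y).smul_const _).add_const _)
    · simp [sum_range_succ']
    · simpa only [pow_succ, mul_apply_eq_comp] using ih (B G) hy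

theorem norm_expProd_apply_sub_taylor_le {B : Fin N → E →L[ℝ] E}
    (hB : ∀ i (x : ℝ) G, ‖NormedSpace.exp (x • B i) G‖ = ‖G‖) (p : ℕ) (G : E) {x : ℝ}
    (hx : 0 ≤ x) :
    ‖expProd B x G - ∑ s ∈ range p, (x ^ s / (s.factorial : ℝ)) • multinomialSum id B s G‖ ≤
      x ^ p / (p.factorial : ℝ) * multinomialSum norm B p G := by
  induction N generalizing p G with
  | zero =>
    rcases p with _ | p
    · simp [multinomialSum_degree_zero]
    · simp [multinomialSum_degree_zero, sum_range_succ', multinomialSum_of_isEmpty]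
  | succ N ih =>
    set Ψ : E →L[ℝ] E := expProd (fun i => B i.succ) x with hΨ
    set w : ℕ → ℝ := fun j => x ^ j / (j.factorial : ℝ)
    set T : ℕ → E → E := fun k A =>
      ∑ s ∈ range k, w s • multinomialSum id (fun i => B i.succ) s A
    have hsplit : expProd B x G - ∑ s ∈ range p, w s • multinomialSum id B s G =
        Ψ (NormedSpace.exp (x • B 0) G - ∑ j ∈ range p, w j • (B 0 ^ j) G) +
          ∑ j ∈ range p, w j • (Ψ ((B 0 ^ j) G) - T (p - j) ((B 0 ^ j) G)) := by
      rw [taylor_multinomialSum_succ, expProd_succ, mul_apply_eq_comp, map_sub, map_sum]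
      simp only [map_smul, smul_sub, sum_sub_distrib, sub_add_sub_cancel, T, w, hΨ]
    rw [hsplit, multinomialSum_norm_succ]
    refine (norm_add_le _ _).trans
      (add_le_add ?_ ((norm_sum_le _ _).trans (sum_le_sum fun j _ => ?_)))
    · rw [norm_expProd_apply fun i => hB i.succ]
      exact norm_exp_smul_apply_sub_taylor_le (hB 0) p G hx
    · have hw : 0 ≤ w j := by positivity
      rw [norm_smul, Real.norm_of_nonneg hw]
      exact mul_le_mul_of_nonneg_left (ih (fun i => hB i.succ) (p - j) _) hw

end ExpProdApply

section Ad

variable {𝔸 : Type*} [NormedRing 𝔸] [NormedAlgebra ℝ 𝔸]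

/-- The derivation `ad a : b ↦ a * b - b * a` as a continuous operator. -/
def ad (a : 𝔸) : 𝔸 →L[ℝ] 𝔸 :=
  ContinuousLinearMap.mul ℝ 𝔸 a - (ContinuousLinearMap.mul ℝ 𝔸).flip a

@[simp]
theorem ad_apply (a b : 𝔸) : ad a b = a * b - b * a := by
  simp [ad]

theorem exp_zero_smul_apply {E : Type*} [NormedAddCommGroup E] [NormedSpace ℝ E]
    (B : E →L[ℝ] E) (G : E) : NormedSpace.exp ((0 : ℝ) • B) G = G :=
  congrArg (fun T : E →L[ℝ] E => T G)
    ((congrArg NormedSpace.exp (zero_smul ℝ B)).trans NormedSpace.exp_zero)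

theorem exp_smul_zero_apply {E : Type*} [NormedAddCommGroup E] [NormedSpace ℝ E] (x : ℝ)
    (G : E) : NormedSpace.exp (x • (0 : E →L[ℝ] E)) G = G :=
  congrArg (fun T : E →L[ℝ] E => T G)
    ((congrArg NormedSpace.exp (smul_zero x)).trans NormedSpace.exp_zero)

variable {N : ℕ}

/-- The left logarithmic derivative of `expProd X`: the generator `X γ` is conjugated by the
factors that stand to its left. -/
def logDeriv (X : Fin N → 𝔸) (x : ℝ) : 𝔸 :=
  ∑ γ, expProd (fun γ' => if γ < γ' then ad (X γ') else 0) x (X γ)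

theorem logDeriv_succ (X : Fin (N + 1) → 𝔸) (x : ℝ) :
    logDeriv X x = logDeriv (fun i => X i.succ) x +
      expProd (fun i => ad (X i.succ)) x (X 0) := by
  rw [logDeriv, Fin.sum_univ_succ, add_comm]
  simp [logDeriv, expProd_succ, exp_smul_zero_apply]

variable [CompleteSpace 𝔸]

theorem exp_smul_mul (a G : 𝔸) (x : ℝ) :
    NormedSpace.exp (x • a) * G =
      NormedSpace.exp (x • ad a) G * NormedSpace.exp (x • a) := by
  let _ := NormedAlgebra.restrictScalars ℚ ℝ 𝔸
  set F : ℝ → 𝔸 := fun t =>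
    NormedSpace.exp (t • -a) * NormedSpace.exp (t • ad a) G * NormedSpace.exp (t • a) with hF
  have hderiv : ∀ t, HasDerivAt F 0 t := fun t => by
    have had : HasDerivAt (fun t : ℝ => NormedSpace.exp (t • ad a) G)
        (a * NormedSpace.exp (t • ad a) G - NormedSpace.exp (t • ad a) G * a) t := by
      simpa using (hasDerivAt_exp_smul_const' (ad a) t).clm_apply (hasDerivAt_const t G)
    refine (((hasDerivAt_exp_smul_const (-a) t).mul had).mul
      (hasDerivAt_exp_smul_const' a t)).congr_deriv ?_
    simp only [Pi.mul_apply]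
    noncomm_ring
  have hconst : F x = F 0 := is_const_of_deriv_eq_zero
    (fun t => (hderiv t).differentiableAt) (fun t => (hderiv t).deriv) x 0
  have hinv : NormedSpace.exp (x • a) * NormedSpace.exp (x • -a) = 1 := by
    rw [smul_neg, ← NormedSpace.exp_add_of_commute (Commute.refl _).neg_right, add_neg_cancel,
      NormedSpace.exp_zero]
  simp only [hF, zero_smul, NormedSpace.exp_zero, exp_zero_smul_apply, one_mul, mul_one] at hconst
  conv_lhs => rw [← hconst, mul_assoc, ← mul_assoc, hinv, one_mul]

theorem expProd_mul (X : Fin N → 𝔸) (G : 𝔸) (x : ℝ) :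
    expProd X x * G = expProd (fun i => ad (X i)) x G * expProd X x := by
  induction N generalizing G with
  | zero => simp
  | succ N ih =>
    rw [expProd_succ, expProd_succ, mul_apply_eq_comp, mul_assoc, exp_smul_mul, ← mul_assoc, ih,
      mul_assoc]

theorem hasDerivAt_expProd (X : Fin N → 𝔸) (x : ℝ) :
    HasDerivAt (expProd X) (logDeriv X x * expProd X x) x := by
  induction N with
  | zero => simpa [logDeriv, funext (expProd_of_isEmpty X)] using hasDerivAt_const x (1 : 𝔸)
  | succ N ih =>
    rw [funext (expProd_succ X)]
    refine ((ih fun i => X i.succ).mul (hasDerivAt_exp_smul_const' (X 0) x)).congr_deriv ?_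
    rw [logDeriv_succ, ← mul_assoc _ (X 0), expProd_mul]
    noncomm_ring

end Ad

section Unitary

variable {𝔸 : Type*} [NormedRing 𝔸] [NormedAlgebra ℝ 𝔸] [CompleteSpace 𝔸] [StarRing 𝔸]
  [ContinuousStar 𝔸] [StarModule ℝ 𝔸] {N : ℕ}

theorem exp_smul_mem_unitary {a : 𝔸} (ha : a ∈ skewAdjoint 𝔸) (x : ℝ) :
    NormedSpace.exp (x • a) ∈ unitary 𝔸 := by
  let _ := NormedAlgebra.restrictScalars ℚ ℝ 𝔸
  exact NormedSpace.exp_mem_unitary_of_mem_skewAdjoint (skewAdjoint.smul_mem x ha)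

theorem expProd_mem_unitary {X : Fin N → 𝔸} (hX : ∀ i, X i ∈ skewAdjoint 𝔸) (x : ℝ) :
    expProd X x ∈ unitary 𝔸 :=
  revProd_mem fun i => exp_smul_mem_unitary (hX i) x

theorem expProd_mul_deriv_star {X : Fin N → 𝔸} (hX : ∀ i, X i ∈ skewAdjoint 𝔸) (x : ℝ) :
    expProd X x * deriv (fun y => star (expProd X y)) x = -logDeriv X x := by
  have hprod := (hasDerivAt_expProd X x).mul (hasDerivAt_expProd X x).star
  have hone : (expProd X * fun y => star (expProd X y)) = fun _ => 1 :=
    funext fun y => Unitary.mul_star_self_of_mem (expProd_mem_unitary hX y)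
  rw [hone] at hprod
  have h0 := hprod.unique (hasDerivAt_const x 1)
  rw [mul_assoc, Unitary.mul_star_self_of_mem (expProd_mem_unitary hX x), mul_one] at h0
  rw [(hasDerivAt_expProd X x).star.deriv]
  exact eq_neg_of_add_eq_zero_right h0

theorem expProd_mul_mul_star {X : Fin N → 𝔸} (hX : ∀ i, X i ∈ skewAdjoint 𝔸) (G : 𝔸) (x : ℝ) :
    expProd X x * G * star (expProd X x) = expProd (fun i => ad (X i)) x G := by
  rw [expProd_mul, mul_assoc, Unitary.mul_star_self_of_mem (expProd_mem_unitary hX x), mul_one]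

end Unitary

section CStarRing

variable {𝔸 : Type*} [NormedRing 𝔸] [NormedAlgebra ℝ 𝔸] [CompleteSpace 𝔸] [StarRing 𝔸]
  [CStarRing 𝔸] [StarModule ℝ 𝔸]

theorem norm_exp_smul_ad_apply {a : 𝔸} (ha : a ∈ skewAdjoint 𝔸) (x : ℝ) (G : 𝔸) :
    ‖NormedSpace.exp (x • ad a) G‖ = ‖G‖ := by
  have hU := exp_smul_mem_unitary ha x
  rw [← CStarRing.norm_mul_mem_unitary _ hU, ← exp_smul_mul,
    CStarRing.norm_mem_unitary_mul _ hU]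

end CStarRing

/-- The logarithmic derivative `V⁻¹ V'` of `V = exp (x Y) (expProd X x)†`, see
`hasDerivAt_remainder`; it measures the failure of `expProd X` to solve `S' = Y S`. -/
def remainderGen {𝔸 : Type*} [NormedRing 𝔸] [NormedAlgebra ℝ 𝔸] {N : ℕ} (X : Fin N → 𝔸) (Y : 𝔸)
    (x : ℝ) : 𝔸 :=
  expProd (fun γ => ad (X γ)) x Y - logDeriv X x

/-- The Taylor coefficients of `remainderGen X Y`, as nested commutators. -/
def remainderCoeff {𝔸 : Type*} [NormedRing 𝔸] [NormedAlgebra ℝ 𝔸] {N : ℕ} (X : Fin N → 𝔸)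
    (Y : 𝔸) (s : ℕ) : 𝔸 :=
  multinomialSum id (fun γ => ad (X γ)) s Y -
    ∑ γ, multinomialSum id (fun γ' => if γ < γ' then ad (X γ') else 0) s (X γ)

/-- The sum of the sizes, measured by `ν`, of all the terms of `remainderCoeff X Y s`. -/
def remainderBound {𝔸 : Type*} [NormedRing 𝔸] [NormedAlgebra ℝ 𝔸] {N : ℕ} (ν : 𝔸 → ℝ)
    (X : Fin N → 𝔸) (Y : 𝔸) (s : ℕ) : ℝ :=
  multinomialSum ν (fun γ => ad (X γ)) s Y +
    ∑ γ, multinomialSum ν (fun γ' => if γ < γ' then ad (X γ') else 0) s (X γ)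

section Remainder

open Finset

variable {𝔸 : Type*} [NormedRing 𝔸] [NormedAlgebra ℝ 𝔸] {N : ℕ} {X : Fin N → 𝔸} {Y : 𝔸}

theorem iteratedDeriv_remainderGen [CompleteSpace 𝔸] (X : Fin N → 𝔸) (Y : 𝔸) (s : ℕ) :
    iteratedDeriv s (remainderGen X Y) 0 = remainderCoeff X Y s := by
  have hle : (s : WithTop ℕ∞) ≤ ∞ := mod_cast le_top
  have hsmooth : ∀ (B : Fin N → 𝔸 →L[ℝ] 𝔸) G,
      ContDiffAt ℝ s (fun x => expProd B x G) 0 := fun B G =>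
    ((contDiff_expProd_apply B G).of_le hle).contDiffAt
  unfold remainderGen logDeriv
  rw [iteratedDeriv_fun_sub (hsmooth _ _) (ContDiffAt.sum fun γ _ => hsmooth _ _),
    iteratedDeriv_fun_sum fun γ _ => hsmooth _ _]
  simp only [iteratedDeriv_expProd_apply, remainderCoeff]

variable [StarRing 𝔸]

theorem ad_mem_skewAdjoint {a b : 𝔸} (ha : a ∈ skewAdjoint 𝔸) (hb : b ∈ skewAdjoint 𝔸) :
    ad a b ∈ skewAdjoint 𝔸 := by
  rw [skewAdjoint.mem_iff] at *
  simp [ha, hb]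

theorem remainderCoeff_mem_skewAdjoint (hX : ∀ γ, X γ ∈ skewAdjoint 𝔸)
    (hY : Y ∈ skewAdjoint 𝔸) (s : ℕ) : remainderCoeff X Y s ∈ skewAdjoint 𝔸 := by
  refine sub_mem (multinomialSum_mem (fun γ _ hG => ad_mem_skewAdjoint (hX γ) hG) hY) <|
    sum_mem fun γ _ => multinomialSum_mem (fun γ' G hG => ?_) (hX γ)
  split_ifs
  · exact ad_mem_skewAdjoint (hX γ') hG
  · exact zero_mem _

variable [CompleteSpace 𝔸] [CStarRing 𝔸] [StarModule ℝ 𝔸]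

theorem norm_remainderGen_sub_taylor_le (hX : ∀ γ, X γ ∈ skewAdjoint 𝔸) (Y : 𝔸) (p : ℕ) {x : ℝ}
    (hx : 0 ≤ x) :
    ‖remainderGen X Y x - ∑ s ∈ range p, (x ^ s / (s.factorial : ℝ)) • remainderCoeff X Y s‖ ≤
      x ^ p / (p.factorial : ℝ) * remainderBound norm X Y p := by
  have hiso : ∀ (P : Fin N → Prop) [DecidablePred P] γ (x : ℝ) G,
      ‖NormedSpace.exp (x • if P γ then ad (X γ) else 0) G‖ = ‖G‖ := fun P _ γ x G => by
    split_ifs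
    · exact norm_exp_smul_ad_apply (hX γ) x G
    · rw [exp_smul_zero_apply]
  simp only [remainderGen, logDeriv, remainderCoeff, remainderBound, smul_sub, sum_sub_distrib]
  simp only [smul_sum]
  rw [sum_comm, sub_sub_sub_comm, ← sum_sub_distrib, mul_add, mul_sum]
  refine (norm_sub_le _ _).trans (add_le_add ?_ ?_)
  · exact norm_expProd_apply_sub_taylor_le (fun γ => norm_exp_smul_ad_apply (hX γ)) p Y hx
  · exact (norm_sum_le _ _).trans (sum_le_sum fun γ _ =>
      norm_expProd_apply_sub_taylor_le (hiso (γ < ·)) p (X γ) hx)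

theorem remainderGen_eq (hX : ∀ γ, X γ ∈ skewAdjoint 𝔸) (Y : 𝔸) (x : ℝ) :
    remainderGen X Y x = expProd X x *
      (deriv (fun y => star (expProd X y)) x + Y * star (expProd X x)) := by
  rw [mul_add, expProd_mul_deriv_star hX, ← mul_assoc, expProd_mul_mul_star hX, neg_add_eq_sub,
    remainderGen]

theorem hasDerivAt_remainder (hX : ∀ γ, X γ ∈ skewAdjoint 𝔸) (Y : 𝔸) (x : ℝ) :
    HasDerivAt (fun y => NormedSpace.exp (y • Y) * star (expProd X y))
      (NormedSpace.exp (x • Y) * star (expProd X x) * remainderGen X Y x) x := by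
  refine ((hasDerivAt_exp_smul_const Y x).mul
    (hasDerivAt_expProd X x).star.differentiableAt.hasDerivAt).congr_deriv ?_
  rw [remainderGen_eq hX, mul_assoc (NormedSpace.exp _) (star _), ← mul_assoc (star _),
    Unitary.star_mul_self_of_mem (expProd_mem_unitary hX x), one_mul, mul_add, mul_assoc,
    add_comm]

theorem remainder_mem_unitary (hX : ∀ γ, X γ ∈ skewAdjoint 𝔸) (hY : Y ∈ skewAdjoint 𝔸) (x : ℝ) :
    NormedSpace.exp (x • Y) * star (expProd X x) ∈ unitary 𝔸 :=
  mul_mem (exp_smul_mem_unitary hY x) (Unitary.star_mem (expProd_mem_unitary hX x))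

variable {K : ℕ} (hX : ∀ γ, X γ ∈ skewAdjoint 𝔸) (hY : Y ∈ skewAdjoint 𝔸)
  (h0 : ∀ s < K, remainderCoeff X Y s = 0) {x : ℝ} (hx : 0 ≤ x)

include hX hY h0 hx

theorem norm_remainder_sub_one_le :
    ‖NormedSpace.exp (x • Y) * star (expProd X x) - 1‖ ≤
      x ^ (K + 1) / ((K + 1).factorial : ℝ) * remainderBound norm X Y K := by
  refine norm_le_of_norm_deriv_le_pow
    (f := fun y => NormedSpace.exp (y • Y) * star (expProd X y) - 1)
    (fun y => (hasDerivAt_remainder hX Y y).sub_const 1) (by simp [expProd_apply_zero])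
    (fun y hy => ?_) hx
  have hJ := norm_remainderGen_sub_taylor_le hX Y K hy
  rwa [sum_eq_zero fun s hs => by rw [h0 s (mem_range.1 hs), smul_zero], sub_zero,
    ← CStarRing.norm_mem_unitary_mul _ (remainder_mem_unitary hX hY y)] at hJ

theorem norm_remainder_mul_remainderGen_sub_le (M : ℕ) :
    ‖NormedSpace.exp (x • Y) * star (expProd X x) * remainderGen X Y x -
        ∑ s ∈ Icc K M, (x ^ s / (s.factorial : ℝ)) • remainderCoeff X Y s‖ ≤
      x ^ (K + 1) / ((K + 1).factorial : ℝ) * remainderBound norm X Y K *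
          ∑ s ∈ Icc K M, x ^ s / (s.factorial : ℝ) * ‖remainderCoeff X Y s‖ +
        x ^ (M + 1) / ((M + 1).factorial : ℝ) * remainderBound norm X Y (M + 1) := by
  set V := NormedSpace.exp (x • Y) * star (expProd X x)
  set T := ∑ s ∈ Icc K M, (x ^ s / (s.factorial : ℝ)) • remainderCoeff X Y s
  have hTrange : ∑ s ∈ range (M + 1), (x ^ s / (s.factorial : ℝ)) • remainderCoeff X Y s = T := by
    refine (sum_subset (fun s hs => ?_) fun s hs hsK => ?_).symm
    · exact mem_range.2 (Nat.lt_succ_of_le (mem_Icc.1 hs).2)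
    · have hsK' : s < K := not_le.1 fun hKs =>
        hsK (mem_Icc.2 ⟨hKs, Nat.lt_succ_iff.1 (mem_range.1 hs)⟩)
      rw [h0 s hsK', smul_zero]
  have hTnorm : ‖T‖ ≤ ∑ s ∈ Icc K M, x ^ s / (s.factorial : ℝ) * ‖remainderCoeff X Y s‖ :=
    (norm_sum_le _ _).trans_eq <| sum_congr rfl fun s _ => by
      rw [norm_smul, Real.norm_of_nonneg (by positivity)]
  have hV1 := norm_remainder_sub_one_le hX hY h0 hx
  have hJ := norm_remainderGen_sub_taylor_le hX Y (M + 1) hx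
  rw [hTrange, ← CStarRing.norm_mem_unitary_mul _ (remainder_mem_unitary hX hY x)] at hJ
  calc ‖V * remainderGen X Y x - T‖ = ‖(V - 1) * T + V * (remainderGen X Y x - T)‖ := by
        congr 1; noncomm_ring
    _ ≤ ‖V - 1‖ * ‖T‖ + ‖V * (remainderGen X Y x - T)‖ :=
        (norm_add_le _ _).trans (by gcongr; exact norm_mul_le _ _)
    _ ≤ _ := add_le_add (mul_le_mul hV1 hTnorm (norm_nonneg _) ((norm_nonneg _).trans hV1)) hJ

theorem norm_remainder_sub_taylor_le (M : ℕ) :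
    ‖NormedSpace.exp (x • Y) * star (expProd X x) -
        (1 + ∑ s ∈ Icc K M, (x ^ (s + 1) / ((s + 1).factorial : ℝ)) • remainderCoeff X Y s)‖ ≤
      remainderBound norm X Y K * ∑ s ∈ Icc K M, ‖remainderCoeff X Y s‖ *
          (x ^ (s + K + 2) /
            ((s.factorial : ℝ) * ((K + 1).factorial : ℝ) * ((s + K + 2 : ℕ) : ℝ))) +
        x ^ (M + 2) / ((M + 2).factorial : ℝ) * remainderBound norm X Y (M + 1) := by
  have hderiv : ∀ y, HasDerivAt (fun y => NormedSpace.exp (y • Y) * star (expProd X y) -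
        (1 + ∑ s ∈ Icc K M, (y ^ (s + 1) / ((s + 1).factorial : ℝ)) • remainderCoeff X Y s))
      (NormedSpace.exp (y • Y) * star (expProd X y) * remainderGen X Y y -
        ∑ s ∈ Icc K M, (y ^ s / (s.factorial : ℝ)) • remainderCoeff X Y s) y := fun y =>
    (hasDerivAt_remainder hX Y y).sub <| (HasDerivAt.fun_sum fun s _ =>
      (hasDerivAt_pow_div_factorial s y).smul_const _).const_add 1
  refine image_norm_le_of_norm_deriv_right_le_deriv_boundary
    (fun y _ => (hderiv y).continuousAt.continuousWithinAt)
    (fun y _ => (hderiv y).hasDerivWithinAt) (by simp [expProd_apply_zero])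
    (fun y => ((HasDerivAt.fun_sum fun s _ =>
      (hasDerivAt_pow_div_factorial_mul_factorial s K y).const_mul
        ‖remainderCoeff X Y s‖).const_mul (remainderBound norm X Y K)).add
      ((hasDerivAt_pow_div_factorial (M + 1) y).mul_const (remainderBound norm X Y (M + 1))))
    (fun y hy => ?_) ⟨hx, le_rfl⟩
  refine (norm_remainder_mul_remainderGen_sub_le hX hY h0 hy.1 M).trans_eq ?_
  rw [mul_comm (_ / _) (remainderBound _ _ _ _), mul_assoc, mul_sum]
  congr 3 with s
  ring

end Remainder

/-- `f` is smooth with `f x = (x ^ p / p !) • R + O (x ^ (p + 1))` at `0`. -/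
structure HasLeadingTerm {E : Type*} [NormedAddCommGroup E] [NormedSpace ℝ E] (p : ℕ) (f : ℝ → E)
    (R : E) : Prop where
  contDiff : ContDiff ℝ ∞ f
  iteratedDeriv_lt : ∀ j < p, iteratedDeriv j f 0 = 0
  iteratedDeriv_eq : iteratedDeriv p f 0 = R

namespace HasLeadingTerm

section Linear

variable {E : Type*} [NormedAddCommGroup E] [NormedSpace ℝ E] {p : ℕ} {f g : ℝ → E} {R Q : E}

theorem succ (hf : HasLeadingTerm p f 0) :
    HasLeadingTerm (p + 1) f (iteratedDeriv (p + 1) f 0) :=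
  ⟨hf.contDiff, fun j hj => (Nat.lt_succ_iff_lt_or_eq.1 hj).elim (hf.iteratedDeriv_lt j)
    fun h => h ▸ hf.iteratedDeriv_eq, rfl⟩

theorem of_succ (hf : HasLeadingTerm (p + 1) f R) : HasLeadingTerm p f 0 :=
  ⟨hf.contDiff, fun j hj => hf.iteratedDeriv_lt j (hj.trans p.lt_succ_self),
    hf.iteratedDeriv_lt p p.lt_succ_self⟩

theorem deriv (hf : HasLeadingTerm (p + 1) f R) : HasLeadingTerm p (deriv f) R :=
  ⟨contDiff_deriv hf.contDiff,
    fun j hj => by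
      rw [← iteratedDeriv_succ', hf.iteratedDeriv_lt _ (Nat.succ_lt_succ hj)],
    by rw [← iteratedDeriv_succ', hf.iteratedDeriv_eq]⟩

theorem add (hf : HasLeadingTerm p f R) (hg : HasLeadingTerm p g Q) :
    HasLeadingTerm p (fun x => f x + g x) (R + Q) := by
  have hadd : ∀ j, iteratedDeriv j (fun x => f x + g x) 0 =
      iteratedDeriv j f 0 + iteratedDeriv j g 0 := fun j => by
    have hle : (j : WithTop ℕ∞) ≤ ∞ := mod_cast le_top
    exact iteratedDeriv_fun_add (hf.contDiff.of_le hle).contDiffAt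
      (hg.contDiff.of_le hle).contDiffAt
  refine ⟨hf.contDiff.add hg.contDiff, fun j hj => ?_, ?_⟩
  · rw [hadd, hf.iteratedDeriv_lt j hj, hg.iteratedDeriv_lt j hj, add_zero]
  · rw [hadd, hf.iteratedDeriv_eq, hg.iteratedDeriv_eq]

theorem comp_mul_left (hf : HasLeadingTerm p f R) (c : ℝ) :
    HasLeadingTerm p (fun x => f (c * x)) (c ^ p • R) := by
  have hcomp : ∀ j, iteratedDeriv j (fun x => f (c * x)) 0 = c ^ j • iteratedDeriv j f 0 :=
    fun j => by
      have hle : (j : WithTop ℕ∞) ≤ ∞ := mod_cast le_top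
      simpa using congrFun (iteratedDeriv_comp_const_smul (hf.contDiff.of_le hle) c) 0
  refine ⟨hf.contDiff.comp (contDiff_const.mul contDiff_id), fun j hj => ?_, ?_⟩
  · rw [hcomp, hf.iteratedDeriv_lt j hj, smul_zero]
  · rw [hcomp, hf.iteratedDeriv_eq]

end Linear

section Ring

open Finset

variable {𝔸 : Type*} [NormedRing 𝔸] [NormedAlgebra ℝ 𝔸] {p : ℕ} {f g u v : ℝ → 𝔸} {R Q : 𝔸}

theorem mul (hf : HasLeadingTerm p f R) (hg : ContDiff ℝ ∞ g) :
    HasLeadingTerm p (fun x => f x * g x) (R * g 0) := by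
  refine ⟨hf.contDiff.mul hg, fun j hj => ?_, ?_⟩
  · rw [iteratedDeriv_mul_eq_sum_antidiagonal hf.contDiff hg]
    refine sum_eq_zero fun q hq => ?_
    rw [hf.iteratedDeriv_lt q.1 ((HasAntidiagonal.antidiagonal.fst_le hq).trans_lt hj),
      zero_mul, smul_zero]
  · rw [iteratedDeriv_mul_eq_sum_antidiagonal hf.contDiff hg,
      sum_eq_single_of_mem (p, 0) (by simp) fun q hq hne => ?_]
    · simp [hf.iteratedDeriv_eq]
    · have hlt : q.1 < p := (HasAntidiagonal.antidiagonal.fst_le hq).lt_of_ne fun h =>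
        hne (Prod.ext h (by have := mem_antidiagonal.1 hq; lia))
      rw [hf.iteratedDeriv_lt q.1 hlt, zero_mul, smul_zero]

theorem mul_left (hf : HasLeadingTerm p f R) (hg : ContDiff ℝ ∞ g) :
    HasLeadingTerm p (fun x => g x * f x) (g 0 * R) := by
  refine ⟨hg.mul hf.contDiff, fun j hj => ?_, ?_⟩
  · rw [iteratedDeriv_mul_eq_sum_antidiagonal hg hf.contDiff]
    refine sum_eq_zero fun q hq => ?_
    rw [hf.iteratedDeriv_lt q.2 ((HasAntidiagonal.antidiagonal.snd_le hq).trans_lt hj),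
      mul_zero, smul_zero]
  · rw [iteratedDeriv_mul_eq_sum_antidiagonal hg hf.contDiff,
      sum_eq_single_of_mem (0, p) (by simp) fun q hq hne => ?_]
    · simp [hf.iteratedDeriv_eq]
    · have hlt : q.2 < p := (HasAntidiagonal.antidiagonal.snd_le hq).lt_of_ne fun h =>
        hne (Prod.ext (by have := mem_antidiagonal.1 hq; lia) h)
      rw [hf.iteratedDeriv_lt q.2 hlt, mul_zero, smul_zero]

theorem mul_sub_mul (hf : HasLeadingTerm p (fun x => f x - u x) R)
    (hg : HasLeadingTerm p (fun x => g x - v x) Q) (hfs : ContDiff ℝ ∞ f) (hv : ContDiff ℝ ∞ v)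
    (hf0 : f 0 = 1) (hv0 : v 0 = 1) :
    HasLeadingTerm p (fun x => f x * g x - u x * v x) (R + Q) := by
  have h := (hf.mul hv).add (hg.mul_left hfs)
  simpa [hf0, hv0, sub_mul, mul_sub] using h

/-- A time-symmetric approximation of a one-parameter group never has an error of even order:
`S x * S (-x) = 1` forces `R + R = 0`. -/
theorem succ_of_symmetric (hp : Even p) (hf : HasLeadingTerm p (fun x => f x - u x) R)
    (hfs : ContDiff ℝ ∞ f) (hu : ContDiff ℝ ∞ u) (hfsymm : ∀ x, f x * f (-x) = 1)
    (husymm : ∀ x, u x * u (-x) = 1) (hf0 : f 0 = 1) (hu0 : u 0 = 1) :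
    HasLeadingTerm (p + 1) (fun x => f x - u x)
      (iteratedDeriv (p + 1) (fun x => f x - u x) 0) := by
  have hprod := hf.mul_sub_mul (hf.comp_mul_left (-1)) hfs
    (hu.comp (contDiff_const.mul contDiff_id)) hf0 (by simp [hu0])
  have hsum := hprod.iteratedDeriv_eq
  simp only [neg_one_mul, hfsymm, husymm, sub_self, hp.neg_one_pow, one_smul, ← two_smul ℝ R,
    iteratedDeriv_fun_const_zero] at hsum
  obtain rfl : R = 0 := (smul_eq_zero.1 hsum.symm).resolve_left (two_ne_zero (α := ℝ))
  exact hf.succ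

end Ring

end HasLeadingTerm

/-- Suzuki's composition of five rescaled copies of `S`. -/
def suzukiStep {𝔸 : Type*} [Monoid 𝔸] (c : ℝ) (S : ℝ → 𝔸) (x : ℝ) : 𝔸 :=
  S (c * x) ^ 2 * S ((1 - 4 * c) * x) * S (c * x) ^ 2

theorem suzukiStep_mul_neg {𝔸 : Type*} [Monoid 𝔸] {S : ℝ → 𝔸} (hS : ∀ x, S x * S (-x) = 1)
    (c x : ℝ) : suzukiStep c S x * suzukiStep c S (-x) = 1 := by
  have hcancel : ∀ y a, S y * (S (-y) * a) = a := fun y a => by rw [← mul_assoc, hS, one_mul]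
  simp only [suzukiStep, mul_neg, pow_two, mul_assoc, hcancel, hS]

section OrderConditions

variable {𝔸 : Type*} [NormedRing 𝔸] [NormedAlgebra ℝ 𝔸]

theorem HasLeadingTerm.suzukiStep_sub {p : ℕ} {S U : ℝ → 𝔸} {R : 𝔸}
    (h : HasLeadingTerm p (fun x => S x - U x) R) (hS : ContDiff ℝ ∞ S) (hU : ContDiff ℝ ∞ U)
    (hS0 : S 0 = 1) (hU0 : U 0 = 1) (hUadd : ∀ x y, U (x + y) = U x * U y) (c : ℝ) :
    HasLeadingTerm p (fun x => suzukiStep c S x - U x)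
      ((4 * c ^ p + (1 - 4 * c) ^ p) • R) := by
  have hscale : ∀ {F : ℝ → 𝔸}, ContDiff ℝ ∞ F → ∀ a : ℝ, ContDiff ℝ ∞ fun x => F (a * x) :=
    fun hF a => hF.comp (contDiff_const.mul contDiff_id)
  have hsq := (h.comp_mul_left c).mul_sub_mul (h.comp_mul_left c) (hscale hS c) (hscale hU c)
    (by simp [hS0]) (by simp [hU0])
  have hleft := hsq.mul_sub_mul (h.comp_mul_left (1 - 4 * c)) ((hscale hS c).mul (hscale hS c))
    (hscale hU _) (by simp [hS0]) (by simp [hU0])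
  have hall := hleft.mul_sub_mul hsq
    (((hscale hS c).mul (hscale hS c)).mul (hscale hS (1 - 4 * c)))
    ((hscale hU c).mul (hscale hU c)) (by simp [hS0]) (by simp [hU0])
  have hUstep : ∀ x, U (c * x) * U (c * x) * U ((1 - 4 * c) * x) * (U (c * x) * U (c * x)) =
      U x := fun x => by
    simp only [← hUadd]
    ring_nf
  simp only [hUstep] at hall
  simp only [← pow_two] at hall
  rwa [← add_smul, ← add_smul, ← add_smul,
    show c ^ p + c ^ p + (1 - 4 * c) ^ p + (c ^ p + c ^ p) = 4 * c ^ p + (1 - 4 * c) ^ p by ring]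
    at hall

variable [CompleteSpace 𝔸] {N : ℕ}

theorem hasLeadingTerm_expProd_sub_exp {X : Fin N → 𝔸} {Y : 𝔸} (hXY : ∑ γ, X γ = Y) :
    HasLeadingTerm 1 (fun x => expProd X x - NormedSpace.exp (x • Y)) 0 where
  contDiff := (contDiff_expProd X).sub (contDiff_exp_smul Y)
  iteratedDeriv_lt j hj := by
    obtain rfl : j = 0 := by lia
    simp [expProd_apply_zero]
  iteratedDeriv_eq := by
    have hX := hasDerivAt_expProd X 0
    have hY := hasDerivAt_exp_smul_const' Y (0 : ℝ)
    rw [iteratedDeriv_one, (hX.fun_sub hY).deriv]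
    simp [logDeriv, expProd_apply_zero, hXY]

/-- With `D = S - exp (x Y)` the generator is `(D Y - D') S⁻¹`, so its Taylor expansion starts one
order below that of `D`. -/
theorem remainderCoeff_eq_zero_of_hasLeadingTerm [StarRing 𝔸] [ContinuousStar 𝔸] [StarModule ℝ 𝔸]
    {X : Fin N → 𝔸} (hX : ∀ γ, X γ ∈ skewAdjoint 𝔸) {Y R : 𝔸} {K : ℕ}
    (hD : HasLeadingTerm (K + 1) (fun x => expProd X x - NormedSpace.exp (x • Y)) R) {s : ℕ}
    (hs : s < K) : remainderCoeff X Y s = 0 := by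
  have hgen : remainderGen X Y = fun x =>
      ((expProd X x - NormedSpace.exp (x • Y)) * Y +
        _root_.deriv (fun x => expProd X x - NormedSpace.exp (x • Y)) x * -1) *
          star (expProd X x) := by
    funext x
    have hmul : remainderGen X Y x * expProd X x =
        expProd X x * Y - logDeriv X x * expProd X x := by
      rw [remainderGen, sub_mul, ← expProd_mul]
    have hsplit : remainderGen X Y x * expProd X x * star (expProd X x) = remainderGen X Y x := by
      rw [mul_assoc, Unitary.mul_star_self_of_mem (expProd_mem_unitary hX x), mul_one]
    rw [((hasDerivAt_expProd X x).fun_sub (hasDerivAt_exp_smul_const Y x)).deriv, ← hsplit, hmul]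
    congr 1
    noncomm_ring
  have hstar : ContDiff ℝ ∞ fun x => star (expProd X x) :=
    (starL' ℝ (A := 𝔸)).contDiff.comp (contDiff_expProd X)
  rw [← iteratedDeriv_remainderGen, hgen]
  exact (((hD.of_succ.mul contDiff_const).add (hD.deriv.mul contDiff_const)).mul hstar
    ).iteratedDeriv_lt s hs

end OrderConditions

section SuzukiParam

variable {k : ℕ}

theorem four_rpow_one_div_mem_Ioo (hk : 2 ≤ k) :
    (4 : ℝ) ^ (1 / (2 * (k : ℝ) - 1)) ∈ Set.Ioo 1 2 := by
  have hk' : (2 : ℝ) ≤ k := mod_cast hk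
  have hroot : (4 : ℝ) ^ (1 / 2 : ℝ) = 2 := by
    rw [← Real.sqrt_eq_rpow, show (4 : ℝ) = 2 ^ 2 by norm_num, Real.sqrt_sq zero_le_two]
  refine ⟨Real.one_lt_rpow (by norm_num) (one_div_pos.2 (by linarith)), ?_⟩
  calc (4 : ℝ) ^ (1 / (2 * (k : ℝ) - 1)) < 4 ^ (1 / 2 : ℝ) :=
        Real.rpow_lt_rpow_of_exponent_lt (by norm_num)
          (one_div_lt_one_div_of_lt two_pos (by linarith))
    _ = 2 := hroot

theorem suzukiParam_mem_Ioc (hk : 2 ≤ k) : suzukiParam k ∈ Set.Ioc 0 (1 / 2) := by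
  have ht := four_rpow_one_div_mem_Ioo hk
  exact ⟨one_div_pos.2 (by linarith [ht.2]),
    one_div_le_one_div_of_le two_pos (by linarith [ht.2])⟩

theorem one_sub_four_mul_suzukiParam (hk : 2 ≤ k) :
    1 - 4 * suzukiParam k = -((4 : ℝ) ^ (1 / (2 * (k : ℝ) - 1)) * suzukiParam k) := by
  have hne : 4 - (4 : ℝ) ^ (1 / (2 * (k : ℝ) - 1)) ≠ 0 := by
    linarith [(four_rpow_one_div_mem_Ioo hk).2]
  rw [suzukiParam]
  field_simp
  ring

theorem abs_suzukiParam_le_one (hk : 2 ≤ k) : |suzukiParam k| ≤ 1 := by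
  obtain ⟨hpos, hle⟩ := suzukiParam_mem_Ioc hk
  rw [abs_of_pos hpos]
  linarith

theorem abs_one_sub_four_mul_suzukiParam_le_one (hk : 2 ≤ k) : |1 - 4 * suzukiParam k| ≤ 1 := by
  obtain ⟨hpos, hle⟩ := suzukiParam_mem_Ioc hk
  rw [abs_le]
  constructor <;> linarith

theorem four_mul_suzukiParam_pow_add (hk : 2 ≤ k) :
    4 * suzukiParam k ^ (2 * k - 1) + (1 - 4 * suzukiParam k) ^ (2 * k - 1) = 0 := by
  have hk' : (2 : ℝ) ≤ k := mod_cast hk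
  have hodd : Odd (2 * k - 1) := ⟨k - 1, by lia⟩
  have hcast : ((2 * k - 1 : ℕ) : ℝ) = 2 * (k : ℝ) - 1 := by
    rw [Nat.cast_sub (by lia)]
    push_cast
    rfl
  have hroot : ((4 : ℝ) ^ (1 / (2 * (k : ℝ) - 1))) ^ (2 * k - 1) = 4 := by
    rw [← Real.rpow_natCast, ← Real.rpow_mul (by norm_num), hcast,
      one_div_mul_cancel (by linarith), Real.rpow_one]
  rw [one_sub_four_mul_suzukiParam hk, hodd.neg_pow, mul_pow, hroot]
  ring

end SuzukiParam

section Stages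

variable {K L : ℕ}

theorem abs_suzukiStages_le_one {k : ℕ} {p : ℝ × Bool} (hp : p ∈ suzukiStages k) :
    |p.1| ≤ 1 := by
  induction k generalizing p with
  | zero => simp [suzukiStages] at hp
  | succ k ih =>
    cases k with
    | zero =>
      simp only [suzukiStages, List.mem_cons, List.not_mem_nil, or_false] at hp
      rcases hp with rfl | rfl <;> norm_num [abs_of_pos]
    | succ k =>
      have hscale : ∀ u : ℝ, |u| ≤ 1 →
          ∀ q ∈ (suzukiStages (k + 1)).map fun q => (u * q.1, q.2), |q.1| ≤ 1 := by
        intro u hu q hq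
        obtain ⟨r, hr, rfl⟩ := List.mem_map.1 hq
        rw [abs_mul]
        exact mul_le_one₀ hu (abs_nonneg _) (ih hr)
      have hc := hscale _ (abs_suzukiParam_le_one (Nat.le_add_left 2 k))
      have hd := hscale _ (abs_one_sub_four_mul_suzukiParam_le_one (Nat.le_add_left 2 k))
      simp only [suzukiStages, List.mem_append] at hp
      rcases hp with (((hp | hp) | hp) | hp) | hp
      exacts [hc p hp, hc p hp, hd p hp, hc p hp, hc p hp]

theorem abs_trotterStages_le_one {p : ℝ × Bool} (hp : p ∈ trotterStages K) : |p.1| ≤ 1 := by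
  unfold trotterStages at hp
  split_ifs at hp
  · simp [List.mem_singleton.1 hp]
  · exact abs_suzukiStages_le_one hp

theorem abs_stepCoeff_le_one (γ : Fin (stepCount K L)) : |stepCoeff K L γ| ≤ 1 := by
  obtain ⟨p, hp, hq⟩ := List.mem_flatMap.1 (List.get_mem (trotterSteps K L) γ)
  obtain ⟨l, -, hl⟩ := List.mem_map.1 hq
  rw [stepCoeff, ← hl]
  exact abs_trotterStages_le_one hp

theorem sum_stageSteps {M : Type*} [AddCommMonoid M] (F : ℝ × Fin L → M) (p : ℝ × Bool) :
    ((stageSteps L p).map F).sum = ∑ l, F (p.1, l) := by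
  unfold stageSteps
  split_ifs <;>
    simp [Function.comp_def, List.sum_reverse, ← List.ofFn_eq_map, List.sum_ofFn]

theorem sum_trotterSteps {M : Type*} [AddCommMonoid M] (F : ℝ × Fin L → M) :
    ∑ γ : Fin (stepCount K L), F ((trotterSteps K L).get γ) =
      ((trotterStages K).map fun p => ∑ l, F (p.1, l)).sum := by
  refine (Fin.sum_univ_fun_getElem (trotterSteps K L) F).trans ?_
  rw [trotterSteps, List.map_flatMap, List.flatMap_def, List.sum_flatten, List.map_map]
  simp only [Function.comp_def, sum_stageSteps]

theorem sum_stepCoeff_smul {E : Type*} [AddCommGroup E] [Module ℝ E]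
    (hsum : ((trotterStages K).map Prod.fst).sum = 1) (F : Fin L → E) :
    ∑ γ : Fin (stepCount K L), stepCoeff K L γ • F ((trotterSteps K L).get γ).2 = ∑ l, F l := by
  refine (sum_trotterSteps fun q => q.1 • F q.2).trans ?_
  simp only [← Finset.smul_sum]
  conv_rhs => rw [← one_smul ℝ (∑ l, F l), ← hsum, List.sum_smul, List.map_map]
  rfl

end Stages

section Bridge

open Finset

variable {n L : ℕ}

/-- The generator `-i H` of `evolution H`. -/
def evolutionGenerator (H : Op n) : Op n := (-Complex.I) • H

theorem evolutionGenerator_mem_skewAdjoint {H : Op n} (hH : H.IsHermitian) :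
    evolutionGenerator H ∈ skewAdjoint (Op n) := by
  rw [skewAdjoint.mem_iff, evolutionGenerator, star_smul, Matrix.star_eq_conjTranspose, hH.eq]
  simp

theorem evolutionGenerator_sum (h : Fin L → Op n) :
    evolutionGenerator (∑ l, h l) = ∑ l, evolutionGenerator (h l) :=
  smul_sum

theorem evolution_mul_eq_exp (H : Op n) (x a : ℝ) :
    evolution H (x * a) = NormedSpace.exp (x • a • evolutionGenerator H) := by
  rw [evolution, evolutionGenerator, ← Complex.coe_smul x, ← Complex.coe_smul a, smul_smul,
    smul_smul]
  congr 2
  push_cast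
  ring

theorem evolution_eq_exp (H : Op n) (x : ℝ) :
    evolution H x = NormedSpace.exp (x • evolutionGenerator H) := by
  simpa using evolution_mul_eq_exp H x 1

theorem evolution_add (H : Op n) (x y : ℝ) :
    evolution H (x + y) = evolution H x * evolution H y := by
  simp only [evolution_eq_exp, add_smul]
  exact Matrix.exp_add_of_commute _ _
    (((Commute.refl (evolutionGenerator H)).smul_left x).smul_right y)

/-- The generators `-i a_γ H_γ` of the steps of the `K`th-order Trotter formula. -/
def stepGenerator (K : ℕ) (h : Fin L → Op n) (γ : Fin (stepCount K L)) : Op n :=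
  stepCoeff K L γ • evolutionGenerator (stepOp K h γ)

theorem sum_stepGenerator {K : ℕ} (hsum : ((trotterStages K).map Prod.fst).sum = 1)
    (h : Fin L → Op n) :
    ∑ γ, stepGenerator K h γ = evolutionGenerator (∑ l, h l) :=
  (sum_stepCoeff_smul hsum fun l => evolutionGenerator (h l)).trans (evolutionGenerator_sum h).symm

theorem stepsProd_eq_expProd (h : Fin L → Op n) (T : List (ℝ × Fin L)) :
    stepsProd h T = expProd fun i : Fin T.length =>
      (T.get i).1 • evolutionGenerator (h (T.get i).2) := by
  funext x
  rw [stepsProd, expProd, revProd]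
  simp only [← evolution_mul_eq_exp]
  conv_lhs => rw [← List.ofFn_get T, List.map_ofFn]
  rfl

theorem ad_stepGenerator_smul (K : ℕ) (h : Fin L → Op n) (γ : Fin (stepCount K L)) (G : Op n) :
    ad (stepGenerator K h γ) • G =
      ((-(Complex.I * (stepCoeff K L γ : ℂ))) • adj (stepOp K h γ)) • G := by
  change ad (stepGenerator K h γ) G =
    (-(Complex.I * (stepCoeff K L γ : ℂ))) • (stepOp K h γ * G - G * stepOp K h γ)
  rw [ad_apply, stepGenerator, evolutionGenerator, ← Complex.coe_smul, smul_smul,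
    show (stepCoeff K L γ : ℂ) * -Complex.I = -(Complex.I * stepCoeff K L γ) by ring,
    smul_mul_assoc, mul_smul_comm, smul_sub]

theorem smul_sum_multinomial_smul_orderedPow (K : ℕ) (h : Fin L → Op n)
    (I : Finset (Fin (stepCount K L))) (s : ℕ) (c : ℂ) (G : Op n) :
    c • ∑ m ∈ piAntidiag I s, (Nat.multinomial I m : ℂ) •
        orderedPow (fun γ => (-(Complex.I * (stepCoeff K L γ : ℂ))) • adj (stepOp K h γ)) m G =
      multinomialSum id (fun γ => if γ ∈ I then ad (stepGenerator K h γ) else 0) s (c • G) := by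
  have hend := sum_multinomial_piAntidiag_eq_multinomialSum (ν := id) rfl
    (fun γ => (-(Complex.I * (stepCoeff K L γ : ℂ))) • adj (stepOp K h γ)) I s G
  simp only [Nat.cast_smul_eq_nsmul]
  refine (congrArg (c • ·) hend).trans ?_
  rw [← multinomialSum_smul (ν := id) (r := c) fun _ => rfl]
  refine multinomialSum_congr id (fun γ G => ?_) s (c • G)
  split_ifs
  · exact (ad_stepGenerator_smul K h γ G).symm
  · rfl

theorem compCoeff_eq_remainderCoeff (K : ℕ) (h : Fin L → Op n) (s : ℕ) :
    compCoeff K h s = remainderCoeff (stepGenerator K h) (evolutionGenerator (∑ l, h l)) s := by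
  have hgen : ∀ γ, (-Complex.I) • (stepCoeff K L γ : ℂ) • stepOp K h γ = stepGenerator K h γ :=
    fun γ => by rw [smul_comm, Complex.coe_smul, stepGenerator, evolutionGenerator]
  rw [compCoeff, ← neg_sub_neg, ← neg_smul, ← neg_smul,
    smul_sum (s := (univ : Finset (Fin (stepCount K L))))]
  simp only [smul_sum_multinomial_smul_orderedPow, hgen, mem_Ioi, mem_univ, if_true]
  rfl

variable {h : Fin L → Op n} (hh : ∀ l, (h l).IsHermitian)

include hh

theorem stepGenerator_mem_skewAdjoint (K : ℕ) (γ : Fin (stepCount K L)) :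
    stepGenerator K h γ ∈ skewAdjoint (Op n) :=
  skewAdjoint.smul_mem _ (evolutionGenerator_mem_skewAdjoint (hh _))

theorem sum_generator_mem_skewAdjoint :
    evolutionGenerator (∑ l, h l) ∈ skewAdjoint (Op n) := by
  rw [evolutionGenerator_sum]
  exact sum_mem fun l _ => evolutionGenerator_mem_skewAdjoint (hh l)

theorem trotter_eq_expProd (K : ℕ) : trotter K h = expProd (stepGenerator K h) :=
  (funext (trotter_eq_stepsProd K h hh)).trans (stepsProd_eq_expProd h _)

theorem trotterRemainder_eq (K : ℕ) (x : ℝ) :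
    trotterRemainder K h x =
      NormedSpace.exp (x • evolutionGenerator (∑ l, h l)) *
        star (expProd (stepGenerator K h) x) := by
  rw [trotterRemainder, evolution_eq_exp, trotter_eq_expProd hh, Matrix.star_eq_conjTranspose]

theorem derivRemainder_eq_remainderGen (K : ℕ) :
    derivRemainder K h = remainderGen (stepGenerator K h) (evolutionGenerator (∑ l, h l)) := by
  funext x
  rw [remainderGen_eq (stepGenerator_mem_skewAdjoint hh K), derivRemainder, trotter_eq_expProd hh,
    evolutionGenerator, smul_mul_assoc, neg_smul, ← sub_eq_add_neg]
  rfl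

theorem compCoeff_mem_skewAdjoint (K s : ℕ) : compCoeff K h s ∈ skewAdjoint (Op n) := by
  rw [compCoeff_eq_remainderCoeff]
  exact remainderCoeff_mem_skewAdjoint (stepGenerator_mem_skewAdjoint hh K)
    (sum_generator_mem_skewAdjoint hh) s

theorem compCoeff_eq_iteratedDeriv (K s : ℕ) :
    compCoeff K h s = iteratedDeriv s (derivRemainder K h) 0 := by
  rw [compCoeff_eq_remainderCoeff, derivRemainder_eq_remainderGen hh, iteratedDeriv_remainderGen]

end Bridge

section TrotterOrder

variable {n L : ℕ} {h : Fin L → Op n} (hh : ∀ l, (h l).IsHermitian)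

theorem trotter_two_mul (k : ℕ) (h : Fin L → Op n) : trotter (2 * k) h = suzuki h k := by
  funext x
  rw [trotter, if_neg (by lia), Nat.mul_div_cancel_left k two_pos]

include hh

theorem contDiff_trotter (K : ℕ) : ContDiff ℝ ∞ (trotter K h) := by
  rw [trotter_eq_expProd hh]
  exact contDiff_expProd _

theorem trotter_zero (K : ℕ) : trotter K h 0 = 1 := by
  rw [trotter_eq_expProd hh, expProd_apply_zero]

theorem suzuki_mul_neg (k : ℕ) (x : ℝ) : suzuki h k x * suzuki h k (-x) = 1 := by
  induction k generalizing x with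
  | zero => exact one_mul 1
  | succ k ih =>
    cases k with
    | zero =>
      have hU : ∀ y, trotterOne h y ∈ unitary (Op n) := fun y => by
        have htrotter : trotterOne h y = expProd (stepGenerator 1 h) y :=
          congrFun (trotter_eq_expProd hh 1) y
        exact htrotter ▸ expProd_mem_unitary (stepGenerator_mem_skewAdjoint hh 1) y
      change star (trotterOne h (-x / 2)) * trotterOne h (x / 2) *
        (star (trotterOne h (- -x / 2)) * trotterOne h (-x / 2)) = 1
      rw [neg_neg, mul_assoc, ← mul_assoc (trotterOne h (x / 2)),
        Unitary.mul_star_self_of_mem (hU _), one_mul, Unitary.star_mul_self_of_mem (hU _)]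
    | succ k => exact suzukiStep_mul_neg ih _ x

theorem hasLeadingTerm_trotter_sub_evolution {K : ℕ}
    (hsum : ((trotterStages K).map Prod.fst).sum = 1) :
    HasLeadingTerm 1 (fun x => trotter K h x - evolution (∑ l, h l) x) 0 := by
  simpa only [trotter_eq_expProd hh, evolution_eq_exp] using
    hasLeadingTerm_expProd_sub_exp (sum_stepGenerator hsum h)

theorem hasLeadingTerm_suzuki_sub_evolution (k : ℕ) :
    ∃ R, HasLeadingTerm (2 * k + 3)
      (fun x => suzuki h (k + 1) x - evolution (∑ l, h l) x) R := by
  have hUsmooth : ContDiff ℝ ∞ (evolution (∑ l, h l)) := by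
    rw [funext (evolution_eq_exp _)]
    exact contDiff_exp_smul _
  have hU0 : evolution (∑ l, h l) 0 = 1 := by simp [evolution]
  have hUneg : ∀ x, evolution (∑ l, h l) x * evolution (∑ l, h l) (-x) = 1 := fun x => by
    rw [← evolution_add, add_neg_cancel, hU0]
  have hsmooth : ∀ k, ContDiff ℝ ∞ (suzuki h k) := fun k =>
    trotter_two_mul k h ▸ contDiff_trotter hh (2 * k)
  have hzero : ∀ k, suzuki h k 0 = 1 := fun k => trotter_two_mul k h ▸ trotter_zero hh (2 * k)
  have hsucc : ∀ k, HasLeadingTerm (2 * k + 1)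
      (fun x => suzuki h (k + 1) x - evolution (∑ l, h l) x) 0 → ∃ R, HasLeadingTerm (2 * k + 3)
      (fun x => suzuki h (k + 1) x - evolution (∑ l, h l) x) R := fun k hk =>
    ⟨_, hk.succ.succ_of_symmetric ⟨k + 1, by lia⟩ (hsmooth _) hUsmooth (suzuki_mul_neg hh _) hUneg
      (hzero _) hU0⟩
  induction k with
  | zero =>
    refine hsucc 0 ?_
    rw [← trotter_two_mul]
    refine hasLeadingTerm_trotter_sub_evolution hh ?_
    norm_num [trotterStages, suzukiStages]
  | succ k ih =>
    obtain ⟨R, hR⟩ := ih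
    refine hsucc (k + 1) ?_
    have hstep := hR.suzukiStep_sub (hsmooth _) hUsmooth (hzero _) hU0 (evolution_add _)
      (suzukiParam (k + 2))
    rwa [show 2 * k + 3 = 2 * (k + 2) - 1 by lia,
      four_mul_suzukiParam_pow_add (Nat.le_add_left 2 k), zero_smul] at hstep

theorem compCoeff_eq_zero {K : ℕ} (hK : K = 1 ∨ (Even K ∧ 0 < K)) {s : ℕ} (hs : s < K) :
    compCoeff K h s = 0 := by
  have hlead : ∃ R, HasLeadingTerm (K + 1) (fun x => trotter K h x - evolution (∑ l, h l) x) R := by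
    rcases hK with rfl | ⟨heven, hpos⟩
    · exact ⟨_, (hasLeadingTerm_trotter_sub_evolution hh (by simp [trotterStages])).succ⟩
    · obtain ⟨k, rfl⟩ : ∃ k, K = 2 * (k + 1) := by
        obtain ⟨k, rfl⟩ := heven
        exact ⟨k - 1, by lia⟩
      rw [trotter_two_mul]
      exact hasLeadingTerm_suzuki_sub_evolution hh k
  obtain ⟨R, hR⟩ := hlead
  simp only [trotter_eq_expProd hh, evolution_eq_exp] at hR
  rw [compCoeff_eq_remainderCoeff]
  exact remainderCoeff_eq_zero_of_hasLeadingTerm (stepGenerator_mem_skewAdjoint hh K) hR hs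

end TrotterOrder

section Seminorm

open Finset

variable {𝕜 E : Type*} [RCLike 𝕜] [AddCommGroup E] [Module 𝕜 E] (ν : Seminorm 𝕜 E) {N : ℕ}

theorem seminorm_sum_le {ι : Type*} (t : Finset ι) (f : ι → E) :
    ν (∑ i ∈ t, f i) ≤ ∑ i ∈ t, ν (f i) :=
  le_sum_of_subadditive ν (map_zero ν).le (map_add_le_add ν) t f

theorem seminorm_multinomialSum_le {M : Type*} [Monoid M] [MulAction M E] (T : Fin N → M) (s : ℕ)
    (G : E) : ν (multinomialSum id T s G) ≤ multinomialSum ν T s G := by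
  refine (seminorm_sum_le ν _ _).trans_eq (sum_congr rfl fun m _ => ?_)
  rw [← Nat.cast_smul_eq_nsmul 𝕜, map_smul_eq_mul, RCLike.norm_natCast, nsmul_eq_mul, id]

theorem multinomialSum_sum_le {M ι : Type*} [Monoid M] [DistribMulAction M E] (T : Fin N → M)
    (s : ℕ) (t : Finset ι) (G : ι → E) :
    multinomialSum ν T s (∑ i ∈ t, G i) ≤ ∑ i ∈ t, multinomialSum ν T s (G i) := by
  simp only [multinomialSum]
  rw [sum_comm]
  refine sum_le_sum fun m _ => ?_
  rw [← smul_sum, smul_sum]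
  exact nsmul_le_nsmul_right (seminorm_sum_le ν _ _) _

theorem multinomialSum_smul_le {c : Fin N → 𝕜} (hc : ∀ i, ‖c i‖ ≤ 1) {r : 𝕜} (hr : ‖r‖ ≤ 1)
    (T : Fin N → Module.End 𝕜 E) (s : ℕ) (G : E) :
    multinomialSum ν (fun i => c i • T i) s (r • G) ≤ multinomialSum ν T s G := by
  induction N generalizing s r G with
  | zero =>
    rcases eq_or_ne s 0 with rfl | hs
    · rw [multinomialSum_degree_zero, multinomialSum_degree_zero, map_smul_eq_mul]
      exact mul_le_of_le_one_left (apply_nonneg ν G) hr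
    · simp only [multinomialSum_of_isEmpty _ _ hs, le_refl]
  | succ N ih =>
    simp only [multinomialSum_succ]
    refine sum_le_sum fun q _ => nsmul_le_nsmul_right ?_ _
    have hpow : (c 0 • T 0) ^ q.1 • r • G = (c 0 ^ q.1 * r) • T 0 ^ q.1 • G := by
      rw [smul_pow, smul_assoc, smul_comm (T 0 ^ q.1), smul_smul]
    rw [hpow]
    refine ih (fun i => hc i.succ) ?_ (fun i => T i.succ) q.2 _
    rw [norm_mul, norm_pow]
    exact mul_le_one₀ (pow_le_one₀ (norm_nonneg _) (hc 0)) (norm_nonneg _) hr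

end Seminorm

theorem seminorm_remainderCoeff_le {𝕜 𝔸 : Type*} [RCLike 𝕜] [NormedRing 𝔸] [NormedAlgebra ℝ 𝔸]
    [Module 𝕜 𝔸] (ν : Seminorm 𝕜 𝔸) {N : ℕ} (X : Fin N → 𝔸) (Y : 𝔸) (s : ℕ) :
    ν (remainderCoeff X Y s) ≤ remainderBound ν X Y s :=
  (map_sub_le_add ν _ _).trans <| add_le_add (seminorm_multinomialSum_le ν _ s Y) <|
    (seminorm_sum_le ν _ _).trans <|
      Finset.sum_le_sum fun γ _ => seminorm_multinomialSum_le ν _ s (X γ)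

section NestedCommutatorBound

open Finset

variable {n L K : ℕ}

theorem one_le_stageCount (K : ℕ) : (1 : ℝ) ≤ stageCount K := by
  have hpos : 0 < stageCount K := by
    unfold stageCount
    split_ifs <;> positivity
  exact_mod_cast hpos

theorem alphaH_nonneg {ν : Op n → ℝ} (hν : ∀ A, 0 ≤ ν A) (K : ℕ) (h : Fin L → Op n) (s : ℕ) :
    0 ≤ alphaH ν K h s :=
  sum_nonneg fun _ _ => sum_nonneg fun _ _ => mul_nonneg (Nat.cast_nonneg _) (hν _)

theorem alphaCom_eq_multinomialSum {N : ℕ} (ν : Op n → ℝ) (s : ℕ) (A : Fin N → Op n) (B : Op n) :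
    alphaCom ν s A B = multinomialSum ν (fun γ => adj (A γ)) s B := by
  simp only [alphaCom, multinomialSum, nsmul_eq_mul]
  rfl

theorem sum_stepOp (hK : K = 1 ∨ (Even K ∧ 0 < K)) (h : Fin L → Op n) (F : Op n → ℝ) :
    ∑ γ, F (stepOp K h γ) = stageCount K * ∑ l, F (h l) := by
  refine (sum_trotterSteps fun q => F (h q.2)).trans ?_
  simp only [List.map_const', List.sum_replicate, length_trotterStages hK, nsmul_eq_mul]

variable (ν : Seminorm ℂ (Op n)) (h : Fin L → Op n)

theorem multinomialSum_ad_stepGenerator_le (P : Fin (stepCount K L) → Prop) [DecidablePred P]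
    (s : ℕ) {r : ℂ} (hr : ‖r‖ ≤ 1) (G : Op n) :
    multinomialSum ν (fun γ => if P γ then ad (stepGenerator K h γ) else 0) s (r • G) ≤
      alphaCom ν s (stepOp K h) G := by
  set c : Fin (stepCount K L) → ℂ := fun γ =>
    if P γ then -(Complex.I * (stepCoeff K L γ : ℂ)) else 0 with hc
  have hcnorm : ∀ γ, ‖c γ‖ ≤ 1 := fun γ => by
    rw [hc]
    dsimp only
    split_ifs
    · simpa using abs_stepCoeff_le_one γ
    · simp
  rw [alphaCom_eq_multinomialSum]
  refine (multinomialSum_congr ν (fun γ A => ?_) s _).trans_le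
    (multinomialSum_smul_le ν hcnorm hr _ s G)
  by_cases hγ : P γ
  · simp only [hc, if_pos hγ]
    exact ad_stepGenerator_smul K h γ A
  · simp only [hc, if_neg hγ, zero_smul]

theorem remainderBound_le (hK : K = 1 ∨ (Even K ∧ 0 < K)) (s : ℕ) :
    remainderBound ν (stepGenerator K h) (evolutionGenerator (∑ l, h l)) s ≤
      2 * stageCount K * alphaH ν K h s := by
  have hY : multinomialSum ν (fun γ => ad (stepGenerator K h γ)) s
      (evolutionGenerator (∑ l, h l)) ≤ alphaH ν K h s := by
    rw [evolutionGenerator_sum]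
    refine (multinomialSum_sum_le ν _ s _ _).trans (sum_le_sum fun l _ => ?_)
    have hle := multinomialSum_ad_stepGenerator_le (K := K) ν h (fun _ => True) s
      (r := -Complex.I) (by simp) (h l)
    simp only [if_true] at hle
    exact hle
  have hX : ∑ γ, multinomialSum ν (fun γ' => if γ < γ' then ad (stepGenerator K h γ') else 0) s
      (stepGenerator K h γ) ≤ stageCount K * alphaH ν K h s := by
    rw [alphaH, ← sum_stepOp hK h fun B => alphaCom ν s (stepOp K h) B]
    refine sum_le_sum fun γ _ => ?_
    have hr : ‖(stepCoeff K L γ : ℂ) * -Complex.I‖ ≤ 1 := by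
      simpa using abs_stepCoeff_le_one γ
    have hle := multinomialSum_ad_stepGenerator_le ν h (γ < ·) s hr (stepOp K h γ)
    rwa [mul_smul, Complex.coe_smul] at hle
  have hκ := le_mul_of_one_le_left (alphaH_nonneg (apply_nonneg ν) K h s) (one_le_stageCount K)
  calc _ ≤ alphaH ν K h s + stageCount K * alphaH ν K h s := add_le_add hY hX
    _ ≤ 2 * stageCount K * alphaH ν K h s := by linarith

theorem seminorm_compCoeff_le (hK : K = 1 ∨ (Even K ∧ 0 < K)) (s : ℕ) :
    ν (compCoeff K h s) ≤ 2 * stageCount K * alphaH ν K h s := by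
  rw [compCoeff_eq_remainderCoeff]
  exact (seminorm_remainderCoeff_le ν _ _ s).trans (remainderBound_le ν h hK s)

end NestedCommutatorBound

section ErrorBound

open Finset

variable {n L K : ℕ}

theorem sum_Icc_succ_eq {M : Type*} [AddCommMonoid M] (K : ℕ) (f : ℕ → M) :
    ∑ s ∈ Icc (K + 1) (2 * K + 1), f s = ∑ s ∈ Icc K (2 * K), f (s + 1) := by
  rw [← map_add_right_Icc, sum_map]
  rfl

theorem compensation_eq (K : ℕ) (h : Fin L → Op n) (x : ℝ) :
    compensation K h x = 1 + ∑ s ∈ Icc K (2 * K), (x ^ (s + 1) / ((s + 1).factorial : ℝ)) •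
      remainderCoeff (stepGenerator K h) (evolutionGenerator (∑ l, h l)) s := by
  rw [compensation, sum_Icc_succ_eq]
  simp only [Nat.add_sub_cancel, Complex.coe_smul, compCoeff_eq_remainderCoeff]

theorem norm_trotterRemainder_sub_compensation_le (hK : K = 1 ∨ (Even K ∧ 0 < K))
    {h : Fin L → Op n} (hh : ∀ l, (h l).IsHermitian) {x : ℝ} (hx : 0 ≤ x) :
    ‖trotterRemainder K h x - compensation K h x‖ ≤
      4 * (stageCount K : ℝ) ^ 2 * alphaH (fun A => ‖A‖) K h K *
          (∑ s ∈ Icc K (2 * K),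
            alphaH (fun A => ‖A‖) K h s *
              (x ^ (s + K + 2) /
                ((s.factorial : ℝ) * ((K + 1).factorial : ℝ) * ((s + K + 2 : ℕ) : ℝ)))) +
        2 * (stageCount K : ℝ) * (x ^ (2 * K + 2) / ((2 * K + 2).factorial : ℝ)) *
          alphaH (fun A => ‖A‖) K h (2 * K + 1) := by
  have hbound := remainderBound_le (normSeminorm ℂ (Op n)) h hK
  have hcoeff := fun s => (seminorm_remainderCoeff_le (normSeminorm ℂ (Op n)) _ _ s).trans
    (hbound s)
  have hα := alphaH_nonneg (fun A : Op n => norm_nonneg A) K h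
  have hmain := norm_remainder_sub_taylor_le (stepGenerator_mem_skewAdjoint hh K)
    (sum_generator_mem_skewAdjoint hh)
    (fun s hs => compCoeff_eq_remainderCoeff K h s ▸ compCoeff_eq_zero hh hK hs) hx (2 * K)
  rw [← trotterRemainder_eq hh, ← compensation_eq] at hmain
  refine hmain.trans ?_
  calc _ ≤ (2 * stageCount K * alphaH (fun A => ‖A‖) K h K) * ∑ s ∈ Icc K (2 * K),
          (2 * stageCount K * alphaH (fun A => ‖A‖) K h s) * (x ^ (s + K + 2) /
            ((s.factorial : ℝ) * ((K + 1).factorial : ℝ) * ((s + K + 2 : ℕ) : ℝ))) +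
        x ^ (2 * K + 2) / ((2 * K + 2).factorial : ℝ) *
          (2 * stageCount K * alphaH (fun A => ‖A‖) K h (2 * K + 1)) := by
        gcongr with s
        · have := hα K
          positivity
        · exact hbound K
        · exact hcoeff s
        · exact hbound _
    _ = _ := by
        simp only [mul_assoc, ← mul_sum]
        ring

theorem etaSum_nonneg {ν : Op n → ℝ} (hν : ∀ A, 0 ≤ ν A) (K : ℕ) (h : Fin L → Op n) {x : ℝ}
    (hx : 0 ≤ x) : 0 ≤ etaSum ν K h x :=
  sum_nonneg fun _ _ => mul_nonneg (hν _) (by positivity)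

theorem etaSum_le {ν : Op n → ℝ} {h : Fin L → Op n} {c : ℝ}
    (hle : ∀ s, ν (compCoeff K h s) ≤ c * alphaH ν K h s) {x : ℝ} (hx : 0 ≤ x) :
    etaSum ν K h x ≤ c * ∑ s ∈ Icc K (2 * K),
      alphaH ν K h s * (x ^ (s + 1) / ((s + 1).factorial : ℝ)) := by
  rw [etaSum, sum_Icc_succ_eq, mul_sum]
  refine sum_le_sum fun s _ => ?_
  rw [Nat.add_sub_cancel, ← mul_assoc]
  exact mul_le_mul_of_nonneg_right (hle s) (by positivity)

theorem sqrt_one_add_etaSum_sq_le {ν : Op n → ℝ} (hν : ∀ A, 0 ≤ ν A) {h : Fin L → Op n}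
    (hle : ∀ s, ν (compCoeff K h s) ≤ 2 * stageCount K * alphaH ν K h s) {x : ℝ} (hx : 0 ≤ x) :
    Real.sqrt (1 + etaSum ν K h x ^ 2) ≤ Real.sqrt (1 + 4 * (stageCount K : ℝ) ^ 2 *
        (∑ s ∈ Icc K (2 * K),
          alphaH ν K h s * (x ^ (s + 1) / ((s + 1).factorial : ℝ))) ^ 2) := by
  refine Real.sqrt_le_sqrt (add_le_add le_rfl ?_)
  refine (pow_le_pow_left₀ (etaSum_nonneg hν K h hx) (etaSum_le hle hx) 2).trans_eq ?_
  ring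

end ErrorBound

section UnitaryHull

variable {A : Type*} [CStarAlgebra A]

open Complex in
theorem midpoint_exp_arg_add_arccos {z : ℂ} (hz : ‖z‖ ≤ 1) :
    midpoint ℝ (exp ((arg z + Real.arccos ‖z‖ : ℝ) * I)) (exp ((arg z - Real.arccos ‖z‖ : ℝ) * I)) =
      z := by
  have hcos : exp (Real.arccos ‖z‖ * I) + exp (-(Real.arccos ‖z‖ * I)) = 2 * ‖z‖ := by
    rw [← neg_mul, ← two_cos, ← ofReal_cos, Real.cos_arccos (by linarith [norm_nonneg z]) hz]
  rw [midpoint_eq_smul_add, ofReal_add, ofReal_sub, add_mul, sub_mul, sub_eq_add_neg, exp_add,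
    exp_add, ← mul_add, hcos, real_smul, invOf_eq_inv]
  push_cast
  linear_combination norm_mul_exp_arg_mul_I z

/-- Through the functional calculus this is the fact that every point of the unit disc is the
midpoint of two points of the unit circle; finiteness of the spectrum makes these points depend
continuously on the point of the disc. -/
theorem mem_convexHull_unitary {a : A} [IsStarNormal a] (hfin : (spectrum ℂ a).Finite)
    (ha : ‖a‖ ≤ 1) : a ∈ convexHull ℝ (unitary A : Set A) := by
  rcases subsingleton_or_nontrivial A with _ | _
  · exact subset_convexHull ℝ _ (Subsingleton.elim 1 a ▸ one_mem (unitary A))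
  set f : ℝ → ℂ → ℂ := fun t z =>
    Complex.exp ((Complex.arg z + t * Real.arccos ‖z‖ : ℝ) * Complex.I)
  have hcont : ∀ t, ContinuousOn (f t) (spectrum ℂ a) := fun t => hfin.continuousOn _
  have hmem : ∀ t, cfc (f t) a ∈ unitary A := fun t => by
    rw [cfc_unitary_iff (f t) a]
    intro z _
    rw [Complex.star_def, Complex.conj_mul', Complex.norm_exp_ofReal_mul_I]
    simp
  have hmid : midpoint ℝ (cfc (f 1) a) (cfc (f (-1)) a) = a := by
    rw [midpoint_eq_smul_add, ← cfc_add a (f 1) (f (-1)),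
      ← cfc_smul (⅟2 : ℝ) (fun z => f 1 z + f (-1) z) a ((hcont 1).add (hcont (-1)))]
    conv_rhs => rw [← cfc_id ℂ a]
    refine cfc_congr fun z hz => ?_
    have := midpoint_exp_arg_add_arccos ((spectrum.norm_le_norm_of_mem hz).trans ha)
    rw [midpoint_eq_smul_add] at this
    simpa [f, sub_eq_add_neg] using this
  rw [← hmid]
  exact (convex_convexHull ℝ _).midpoint_mem (subset_convexHull ℝ _ (hmem 1))
    (subset_convexHull ℝ _ (hmem (-1)))

end UnitaryHull

section LCU

open scoped Pointwise

variable {n : ℕ}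

theorem isLCUFormulaOver_of_mem_smul_convexHull {E : Set (Op n)} (V : Op n) {W : Op n} {μ : ℝ}
    (hμ : 0 < μ) (hW : W ∈ μ • convexHull ℝ (E ∩ unitary (Op n))) :
    IsLCUFormulaOver E V W μ ‖V - W‖ := by
  obtain ⟨A, hA, rfl⟩ := hW
  obtain ⟨ι, _, U, p, hU, -, hp, hsum, rfl⟩ := eq_pos_convex_span_of_mem_convexHull hA
  have hmem := fun i => hU (Set.mem_range_self i)
  let e := (Fintype.equivFin ι).symm
  refine ⟨hμ, le_rfl, _, p ∘ e, U ∘ e, fun i => hp _, (e.sum_comp p).trans hsum,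
    fun i => (hmem _).2, fun i => (hmem _).1, ?_⟩
  simp only [Complex.coe_smul, Function.comp_apply]
  rw [e.sum_comp fun i => p i • U i]

theorem mem_smul_convexHull_unitary {W : Op n} [IsStarNormal W] {μ : ℝ} (hμ : 0 < μ)
    (hW : ‖W‖ ≤ μ) : W ∈ μ • convexHull ℝ (unitary (Op n) : Set (Op n)) := by
  rw [Set.mem_smul_set_iff_inv_smul_mem₀ hμ.ne']
  refine mem_convexHull_unitary (Matrix.finite_spectrum _) ?_
  rwa [norm_smul, Real.norm_of_nonneg (inv_nonneg.2 hμ.le), inv_mul_le_one₀ hμ]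

theorem isLCUFormula_of_isStarNormal (V : Op n) {W : Op n} [IsStarNormal W] {μ : ℝ} (hμ : 0 < μ)
    (hW : ‖W‖ ≤ μ) : IsLCUFormula V W μ ‖V - W‖ := by
  refine isLCUFormulaOver_of_mem_smul_convexHull V hμ ?_
  rw [Set.univ_inter]
  exact mem_smul_convexHull_unitary hμ hW

theorem isLCUFormula_one_add_of_mem_skewAdjoint (V : Op n) {X : Op n} (hX : X ∈ skewAdjoint (Op n))
    {η : ℝ} (hη : ‖X‖ ≤ η) : IsLCUFormula V (1 + X) (Real.sqrt (1 + η ^ 2)) ‖V - (1 + X)‖ := by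
  have hstar : star X = -X := skewAdjoint.mem_iff.1 hX
  have : IsStarNormal X := skewAdjoint.isStarNormal_of_mem hX
  have : IsStarNormal (1 + X) := inferInstance
  refine isLCUFormula_of_isStarNormal V (Real.sqrt_pos.2 (by positivity)) (Real.le_sqrt_of_sq_le ?_)
  calc ‖1 + X‖ ^ 2 = ‖1 + star X * X‖ := by
        rw [sq, ← CStarRing.norm_star_mul_self, star_add, star_one, hstar]
        congr 1
        noncomm_ring
    _ ≤ 1 + ‖X‖ * ‖X‖ := by
        rw [← CStarRing.norm_star_mul_self]
        exact (norm_add_le _ _).trans (add_le_add norm_one.le le_rfl)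
    _ ≤ 1 + η ^ 2 := by
        rw [← sq]
        gcongr

open ComplexStarModule in
theorem exists_isLCUFormula (V : Op n) : ∃ μ, IsLCUFormula V V μ 0 := by
  set r := ‖V‖ + 1
  have hr : 0 < r := by positivity
  have hre : ‖(ℜ V : Op n)‖ ≤ r := (realPart.norm_le V).trans (lt_add_one _).le
  have him : ‖Complex.I • (ℑ V : Op n)‖ ≤ r := by
    rw [norm_smul, Complex.norm_I, one_mul]
    exact (imaginaryPart.norm_le V).trans (lt_add_one _).le
  have hmem : V ∈ (r + r) • convexHull ℝ (Set.univ ∩ unitary (Op n) : Set (Op n)) := by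
    rw [Set.univ_inter, (convex_convexHull ℝ _).add_smul hr.le hr.le,
      ← realPart_add_I_smul_imaginaryPart V]
    exact Set.add_mem_add (mem_smul_convexHull_unitary hr hre) (mem_smul_convexHull_unitary hr him)
  have hV := isLCUFormulaOver_of_mem_smul_convexHull V (add_pos hr hr) hmem
  rw [sub_self, norm_zero] at hV
  exact ⟨r + r, hV⟩

theorem IsLCUFormulaOver.norm_le {E : Set (Op n)} {V W : Op n} {μ ε : ℝ}
    (hW : IsLCUFormulaOver E V W μ ε) : ‖W‖ ≤ μ := by
  obtain ⟨hμ, -, Γ, p, U, hp, hsum, hU, -, rfl⟩ := hW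
  rw [norm_smul, Complex.norm_real, Real.norm_of_nonneg hμ.le]
  refine mul_le_of_le_one_right hμ.le ((norm_sum_le _ _).trans_eq ?_)
  rw [← hsum]
  refine Finset.sum_congr rfl fun i _ => ?_
  rw [norm_smul, Complex.norm_real, Real.norm_of_nonneg (hp i).le,
    CStarRing.norm_of_mem_unitary (hU i), mul_one]

theorem norm_le_oneNorm (V : Op n) : ‖V‖ ≤ oneNorm V :=
  le_csInf (exists_isLCUFormula V) fun _ hμ => hμ.norm_le

theorem oneNorm_nonneg (V : Op n) : 0 ≤ oneNorm V :=
  (norm_nonneg V).trans (norm_le_oneNorm V)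

theorem oneNorm_eq_norm (V : Op n) [IsStarNormal V] : oneNorm V = ‖V‖ := by
  refine le_antisymm (le_of_forall_gt_imp_ge_of_dense fun μ hμ => ?_) (norm_le_oneNorm V)
  have hV := isLCUFormula_of_isStarNormal V ((norm_nonneg V).trans_lt hμ) hμ.le
  rw [sub_self, norm_zero] at hV
  exact csInf_le ⟨0, fun _ hμ' => hμ'.1.le⟩ hV

end LCU

section Rotation

variable {A : Type*} [NormedRing A] [NormedAlgebra ℝ A]

/-- The complex line `ℝ + ℝ J` is a copy of `ℂ`, so this is Euler's formula. -/
theorem exp_smul_eq_cos_add_sin {J : A} (hJ : J * J = -1) (θ : ℝ) :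
    NormedSpace.exp (θ • J) = Real.cos θ • (1 : A) + Real.sin θ • J := by
  let _ : Algebra ℚ A := RestrictScalars.algebra ℚ ℝ A
  have hcont : Continuous (Complex.liftAux J hJ) :=
    (Complex.liftAux J hJ).toLinearMap.continuous_of_finiteDimensional
  have hexp := NormedSpace.map_exp (Complex.liftAux J hJ) hcont (θ * Complex.I)
  rw [← Complex.exp_eq_exp_ℂ] at hexp
  simpa [Complex.liftAux_apply, Algebra.algebraMap_eq_smul_one] using hexp.symm

theorem sqrt_smul_exp_arctan_smul {J : A} (hJ : J * J = -1) (η : ℝ) :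
    Real.sqrt (1 + η ^ 2) • NormedSpace.exp (Real.arctan η • J) = 1 + η • J := by
  have hsqrt : Real.sqrt (1 + η ^ 2) ≠ 0 := by positivity
  rw [exp_smul_eq_cos_add_sin hJ, smul_add, smul_smul, smul_smul, Real.cos_arctan, Real.sin_arctan,
    mul_one_div_cancel hsqrt, mul_div_cancel₀ _ hsqrt, one_smul]

end Rotation

section PauliString

open Finset

variable {n : ℕ}

theorem star_pauli_apply (k : Fin 4) (a b : Fin 2) : star (pauli k b a) = pauli k a b := by
  fin_cases k <;> fin_cases a <;> fin_cases b <;> simp [pauli]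

theorem pauli_mul_self (k : Fin 4) : pauli k * pauli k = 1 := by
  fin_cases k <;> simp [pauli, Matrix.one_fin_two]

theorem sum_pauli_mul_pauli (a b c d : Fin 2) :
    ∑ k, pauli k a b * pauli k c d = if a = d ∧ b = c then 2 else 0 := by
  fin_cases a <;> fin_cases b <;> fin_cases c <;> fin_cases d <;>
    simp [pauli, Fin.sum_univ_four] <;> norm_num

theorem pauliString_isHermitian (σ : Fin n → Fin 4) : (pauliString σ).IsHermitian := by
  ext a b
  simp only [pauliString, Matrix.conjTranspose_apply, Matrix.of_apply, star_prod, star_pauli_apply]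

theorem pauliString_mul_self (σ : Fin n → Fin 4) : pauliString σ * pauliString σ = 1 := by
  ext a b
  have hqubit : ∀ i, ∑ k, pauli (σ i) (a i) k * pauli (σ i) k (b i) = if a i = b i then 1 else 0 :=
    fun i => by rw [← Matrix.mul_apply, pauli_mul_self, Matrix.one_apply]
  simp only [pauliString, Matrix.mul_apply, Matrix.of_apply, ← prod_mul_distrib]
  rw [← Fintype.prod_sum fun i k => pauli (σ i) (a i) k * pauli (σ i) k (b i)]
  simp only [hqubit, Matrix.one_apply, prod_ite_zero, prod_const_one, mem_univ, true_imp_iff,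
    funext_iff]

theorem sum_pauliString_mul_pauliString (a b c d : Fin n → Fin 2) :
    ∑ σ : Fin n → Fin 4, pauliString σ a b * pauliString σ c d =
      if a = d ∧ b = c then (2 : ℂ) ^ n else 0 := by
  simp only [pauliString, Matrix.of_apply, ← prod_mul_distrib]
  rw [← Fintype.prod_sum fun i k => pauli k (a i) (b i) * pauli k (c i) (d i)]
  simp only [sum_pauli_mul_pauli, prod_ite_zero, prod_const, card_univ, Fintype.card_fin, mem_univ,
    true_imp_iff, funext_iff, forall_and]

theorem sum_pauliCoeff_smul_pauliString (V : Op n) :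
    ∑ σ, pauliCoeff V σ • pauliString σ = V := by
  ext a b
  have hcoeff : ∀ σ : Fin n → Fin 4, pauliCoeff V σ * pauliString σ a b =
      ∑ c, ∑ d, (pauliString σ a b * pauliString σ c d) * (V d c / 2 ^ n) := fun σ => by
    simp only [pauliCoeff, Matrix.trace, Matrix.diag_apply, Matrix.mul_apply, sum_mul, sum_div]
    exact sum_congr rfl fun c _ => sum_congr rfl fun d _ => by ring
  simp only [Matrix.sum_apply, Matrix.smul_apply, smul_eq_mul, hcoeff]
  calc _ = ∑ c, ∑ d, (∑ σ : Fin n → Fin 4, pauliString σ a b * pauliString σ c d) *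
        (V d c / 2 ^ n) := by
        rw [sum_comm]
        refine sum_congr rfl fun c _ => ?_
        rw [sum_comm]
        simp only [sum_mul]
    _ = V a b := by
        simp [sum_pauliString_mul_pauliString, ite_and, mul_div_cancel₀]

theorem pauliCoeff_add (V W : Op n) (σ : Fin n → Fin 4) :
    pauliCoeff (V + W) σ = pauliCoeff V σ + pauliCoeff W σ := by
  simp only [pauliCoeff, mul_add, Matrix.trace_add, add_div]

theorem pauliCoeff_smul (c : ℂ) (V : Op n) (σ : Fin n → Fin 4) :
    pauliCoeff (c • V) σ = c * pauliCoeff V σ := by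
  simp only [pauliCoeff, mul_smul_comm, Matrix.trace_smul, smul_eq_mul, mul_div_assoc]

/-- The Pauli `1`-norm as a seminorm, so that the bounds for seminorms apply to it. -/
def pauliSeminorm (n : ℕ) : Seminorm ℂ (Op n) :=
  Seminorm.of pauliNorm
    (fun V W => by
      simp only [pauliNorm, pauliCoeff_add, ← sum_add_distrib]
      exact sum_le_sum fun σ _ => norm_add_le _ _)
    (fun c V => by simp only [pauliNorm, pauliCoeff_smul, norm_mul, mul_sum])

theorem pauliNorm_nonneg (V : Op n) : 0 ≤ pauliNorm V :=
  apply_nonneg (pauliSeminorm n) V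

theorem eq_zero_of_pauliNorm_eq_zero {V : Op n} (hV : pauliNorm V = 0) : V = 0 := by
  have hcoeff := (sum_eq_zero_iff_of_nonneg fun σ _ => norm_nonneg (pauliCoeff V σ)).1 hV
  rw [← sum_pauliCoeff_smul_pauliString V]
  exact sum_eq_zero fun σ hσ => by rw [norm_eq_zero.1 (hcoeff σ hσ), zero_smul]

end PauliString

section PauliRotation

open Finset

variable {n : ℕ} {C : Op n}

/-- A Pauli string up to sign, the generator of a Pauli rotation `exp (i θ P)`. -/
def IsSignedPauli (P : Op n) : Prop :=
  ∃ σ, P = pauliString σ ∨ P = -pauliString σ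

theorem isSignedPauli_signedPauli (C : Op n) (σ : Fin n → Fin 4) :
    IsSignedPauli (signedPauli C σ) := by
  unfold signedPauli
  split_ifs
  · exact ⟨σ, Or.inl rfl⟩
  · exact ⟨σ, Or.inr rfl⟩

namespace IsSignedPauli

variable {P : Op n}

theorem I_smul_mul_self (hP : IsSignedPauli P) : (Complex.I • P) * (Complex.I • P) = -1 := by
  rw [smul_mul_smul_comm, Complex.I_mul_I, neg_one_smul]
  obtain ⟨σ, rfl | rfl⟩ := hP <;> simp only [neg_mul_neg, pauliString_mul_self]

theorem I_smul_mem_skewAdjoint (hP : IsSignedPauli P) : Complex.I • P ∈ skewAdjoint (Op n) := by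
  have hstar : star P = P := by
    obtain ⟨σ, rfl | rfl⟩ := hP
    · exact pauliString_isHermitian σ
    · exact (pauliString_isHermitian σ).neg
  rw [skewAdjoint.mem_iff, star_smul, hstar, Complex.star_def, Complex.conj_I, neg_smul]

theorem exp_smul_mem_pauliRotations (hP : IsSignedPauli P) (θ : ℝ) :
    NormedSpace.exp (θ • Complex.I • P) ∈ pauliRotations n θ := by
  have hangle : ∀ Q : Op n, θ • Complex.I • Q = (Complex.I * (θ : ℂ)) • Q := fun Q => by
    rw [← Complex.coe_smul, smul_smul, mul_comm]
  obtain ⟨σ, rfl | rfl⟩ := hP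
  · exact ⟨σ, 1, Or.inl rfl, by rw [hangle, Complex.ofReal_one, one_smul]⟩
  · exact ⟨σ, -1, Or.inr rfl, by rw [hangle, Complex.ofReal_neg, Complex.ofReal_one, neg_one_smul]⟩

theorem exp_smul_mem_convexHull (hP : IsSignedPauli P) (θ : ℝ) :
    NormedSpace.exp (θ • Complex.I • P) ∈
      convexHull ℝ (pauliRotations n θ ∩ unitary (Op n) : Set (Op n)) :=
  subset_convexHull ℝ _
    ⟨hP.exp_smul_mem_pauliRotations θ, exp_smul_mem_unitary hP.I_smul_mem_skewAdjoint θ⟩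

end IsSignedPauli

theorem pauliCoeff_re_eq_zero (hC : C ∈ skewAdjoint (Op n)) (σ : Fin n → Fin 4) :
    (pauliCoeff C σ).re = 0 := by
  have hstar : star (pauliCoeff C σ) = -pauliCoeff C σ := by
    rw [pauliCoeff, star_div₀, ← Matrix.trace_conjTranspose, Matrix.conjTranspose_mul,
      ← Matrix.star_eq_conjTranspose C, skewAdjoint.mem_iff.1 hC, (pauliString_isHermitian σ).eq,
      neg_mul, Matrix.trace_neg, Matrix.trace_mul_comm, neg_div]
    simp
  have hre := congrArg Complex.re hstar
  rw [Complex.star_def, Complex.conj_re, Complex.neg_re] at hre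
  linarith

theorem norm_pauliCoeff_smul_signedPauli (hC : C ∈ skewAdjoint (Op n)) (σ : Fin n → Fin 4) :
    ‖pauliCoeff C σ‖ • Complex.I • signedPauli C σ = pauliCoeff C σ • pauliString σ := by
  have hre := pauliCoeff_re_eq_zero hC σ
  have him : pauliCoeff C σ = ((pauliCoeff C σ).im : ℂ) * Complex.I := by
    apply Complex.ext <;> simp [hre]
  conv_rhs => rw [him]
  rw [← Complex.abs_im_eq_norm.2 hre, ← Complex.coe_smul, smul_smul, signedPauli]
  split_ifs with hsign
  · rw [abs_of_nonneg hsign]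
  · rw [abs_of_neg (not_le.1 hsign), smul_neg, ← neg_smul, Complex.ofReal_neg, neg_mul, neg_neg]

theorem sum_norm_pauliCoeff_smul_signedPauli (hC : C ∈ skewAdjoint (Op n)) :
    ∑ σ, ‖pauliCoeff C σ‖ • Complex.I • signedPauli C σ = C := by
  simp only [norm_pauliCoeff_smul_signedPauli hC, sum_pauliCoeff_smul_pauliString]

theorem rotationMixture_eq (C : Op n) (η : ℝ) :
    rotationMixture C η = ∑ σ, (‖pauliCoeff C σ‖ / pauliNorm C) •
      NormedSpace.exp (Real.arctan η • Complex.I • signedPauli C σ) := by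
  refine sum_congr rfl fun σ _ => ?_
  rw [Complex.coe_smul, mul_comm, mul_smul, Complex.coe_smul]

theorem pauliNorm_smul_sqrt_smul_rotationMixture (hC : C ∈ skewAdjoint (Op n)) (η : ℝ) :
    pauliNorm C • Real.sqrt (1 + η ^ 2) • rotationMixture C η =
      pauliNorm C • (1 : Op n) + η • C := by
  rcases eq_or_ne (pauliNorm C) 0 with hN | hN
  · rw [hN, eq_zero_of_pauliNorm_eq_zero hN, zero_smul, zero_smul, smul_zero, add_zero]
  calc _ = ∑ σ, ‖pauliCoeff C σ‖ • (1 + η • Complex.I • signedPauli C σ) := by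
        simp only [rotationMixture_eq, smul_sum]
        refine sum_congr rfl fun σ _ => ?_
        rw [smul_comm (Real.sqrt _),
          sqrt_smul_exp_arctan_smul (isSignedPauli_signedPauli C σ).I_smul_mul_self,
          smul_smul, mul_div_cancel₀ _ hN]
    _ = _ := by
        simp only [smul_add, sum_add_distrib, ← sum_smul, smul_comm _ η, ← smul_sum,
          sum_norm_pauliCoeff_smul_signedPauli hC]
        rfl

theorem rotationMixture_mem_convexHull (hC : C ≠ 0) (η : ℝ) :
    rotationMixture C η ∈
      convexHull ℝ (pauliRotations n (Real.arctan η) ∩ unitary (Op n) : Set (Op n)) := by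
  rw [rotationMixture_eq]
  refine (convex_convexHull ℝ _).sum_mem (fun σ _ => ?_) ?_ fun σ _ =>
    (isSignedPauli_signedPauli C σ).exp_smul_mem_convexHull _
  · exact div_nonneg (norm_nonneg _) (pauliNorm_nonneg C)
  · rw [← sum_div]
    exact div_self (mt eq_zero_of_pauliNorm_eq_zero hC)

open scoped Pointwise in
theorem one_mem_smul_convexHull_pauliRotations (n : ℕ) (η : ℝ) :
    (1 : Op n) ∈ Real.sqrt (1 + η ^ 2) •
      convexHull ℝ (pauliRotations n (Real.arctan η) ∩ unitary (Op n) : Set (Op n)) := by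
  set P : Op n := pauliString 0
  have hrot : ∀ {Q : Op n}, IsSignedPauli Q → 1 + η • Complex.I • Q ∈ Real.sqrt (1 + η ^ 2) •
      convexHull ℝ (pauliRotations n (Real.arctan η) ∩ unitary (Op n) : Set (Op n)) := fun hQ => by
    rw [← sqrt_smul_exp_arctan_smul hQ.I_smul_mul_self]
    exact Set.smul_mem_smul_set (hQ.exp_smul_mem_convexHull _)
  have hmid : midpoint ℝ (1 + η • Complex.I • P) (1 + η • Complex.I • (-P)) = 1 := by
    rw [smul_neg, smul_neg, ← sub_eq_add_neg, midpoint_add_sub]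
  rw [← hmid]
  exact ((convex_convexHull ℝ _).smul _).midpoint_mem (hrot ⟨0, Or.inl rfl⟩)
    (hrot ⟨0, Or.inr rfl⟩)

open scoped Pointwise in
/-- `1 + C` lies between `1` and a multiple of the rotation mixture of `C`. -/
theorem one_add_mem_smul_convexHull_pauliRotations (hC : C ∈ skewAdjoint (Op n)) {η : ℝ}
    (hη : pauliNorm C ≤ η) : 1 + C ∈ Real.sqrt (1 + η ^ 2) •
      convexHull ℝ (pauliRotations n (Real.arctan η) ∩ unitary (Op n) : Set (Op n)) := by
  have hone := one_mem_smul_convexHull_pauliRotations n η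
  rcases eq_or_ne C 0 with rfl | hC0
  · rwa [add_zero]
  have hN : pauliNorm C ≠ 0 := mt eq_zero_of_pauliNorm_eq_zero hC0
  have hη0 : 0 < η := ((pauliNorm_nonneg C).lt_of_ne' hN).trans_le hη
  have hcomb : (1 - pauliNorm C / η) • (1 : Op n) +
      (pauliNorm C / η) • Real.sqrt (1 + η ^ 2) • rotationMixture C η = 1 + C := by
    rw [div_eq_inv_mul, mul_smul, pauliNorm_smul_sqrt_smul_rotationMixture hC, smul_add, smul_smul,
      smul_smul, inv_mul_cancel₀ hη0.ne', sub_smul, one_smul, one_smul]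
    abel
  rw [← hcomb]
  exact (convex_convexHull ℝ _).smul _ hone
    (Set.smul_mem_smul_set (rotationMixture_mem_convexHull hC0 η))
    (sub_nonneg.2 ((div_le_one hη0).2 hη)) (div_nonneg (pauliNorm_nonneg C) hη0.le)
    (sub_add_cancel _ _)

end PauliRotation

section Compensation

open Finset

variable {n L K : ℕ} {h : Fin L → Op n} {x : ℝ}

theorem compensation_sub_one_mem_skewAdjoint (hh : ∀ l, (h l).IsHermitian) (K : ℕ) (x : ℝ) :
    compensation K h x - 1 ∈ skewAdjoint (Op n) := by
  rw [compensation, add_sub_cancel_left]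
  refine sum_mem fun s _ => ?_
  rw [Complex.coe_smul]
  exact skewAdjoint.smul_mem _ (compCoeff_mem_skewAdjoint hh K _)

theorem seminorm_compensation_sub_one_le (ν : Seminorm ℂ (Op n)) (K : ℕ) (h : Fin L → Op n)
    (hx : 0 ≤ x) : ν (compensation K h x - 1) ≤ etaSum ν K h x := by
  rw [compensation, add_sub_cancel_left]
  refine (seminorm_sum_le ν _ _).trans_eq (sum_congr rfl fun s _ => ?_)
  rw [map_smul_eq_mul, Complex.norm_real, Real.norm_of_nonneg (by positivity), mul_comm]

theorem etaSum_mono {ν ν' : Op n → ℝ} (hν : ∀ A, ν A ≤ ν' A) (K : ℕ) (h : Fin L → Op n)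
    (hx : 0 ≤ x) : etaSum ν K h x ≤ etaSum ν' K h x :=
  sum_le_sum fun _ _ => mul_le_mul_of_nonneg_right (hν _) (by positivity)

theorem alphaH_mono {ν ν' : Op n → ℝ} (hν : ∀ A, ν A ≤ ν' A) (K : ℕ) (h : Fin L → Op n) (s : ℕ) :
    alphaH ν K h s ≤ alphaH ν' K h s :=
  sum_le_sum fun _ _ => sum_le_sum fun _ _ => mul_le_mul_of_nonneg_left (hν _) (Nat.cast_nonneg _)

theorem oneNorm_compCoeff_le (hK : K = 1 ∨ (Even K ∧ 0 < K)) (hh : ∀ l, (h l).IsHermitian) (s : ℕ) :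
    oneNorm (compCoeff K h s) ≤ 2 * stageCount K * alphaH oneNorm K h s := by
  have := skewAdjoint.isStarNormal_of_mem (compCoeff_mem_skewAdjoint hh K s)
  rw [oneNorm_eq_norm]
  refine (seminorm_compCoeff_le (normSeminorm ℂ (Op n)) h hK s).trans ?_
  exact mul_le_mul_of_nonneg_left (alphaH_mono norm_le_oneNorm K h s) (by positivity)

theorem isLCUFormula_compensation (hh : ∀ l, (h l).IsHermitian) (hx : 0 ≤ x) (V : Op n) :
    IsLCUFormula V (compensation K h x) (Real.sqrt (1 + etaSum oneNorm K h x ^ 2))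
      ‖V - compensation K h x‖ := by
  have hle := (seminorm_compensation_sub_one_le (normSeminorm ℂ (Op n)) K h hx).trans
    (etaSum_mono norm_le_oneNorm K h hx)
  have hlcu := isLCUFormula_one_add_of_mem_skewAdjoint V
    (compensation_sub_one_mem_skewAdjoint hh K x) hle
  rwa [add_sub_cancel] at hlcu

theorem isLCUFormulaOver_pauliRotations (hh : ∀ l, (h l).IsHermitian) (hx : 0 ≤ x) (V : Op n) :
    IsLCUFormulaOver (pauliRotations n (Real.arctan (etaSum pauliNorm K h x))) V
      (compensation K h x) (Real.sqrt (1 + etaSum pauliNorm K h x ^ 2))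
      ‖V - compensation K h x‖ := by
  refine isLCUFormulaOver_of_mem_smul_convexHull V (by positivity) ?_
  have hmem := one_add_mem_smul_convexHull_pauliRotations
    (compensation_sub_one_mem_skewAdjoint hh K x)
    (seminorm_compensation_sub_one_le (pauliSeminorm n) K h hx)
  rwa [add_sub_cancel] at hmem

theorem compensation_eq_rotationMixture (hh : ∀ l, (h l).IsHermitian)
    (hη : etaSum pauliNorm K h x ≠ 0) :
    compensation K h x = (Real.sqrt (1 + etaSum pauliNorm K h x ^ 2) : ℂ) •
      ∑ s ∈ Icc (K + 1) (2 * K + 1),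
        ((pauliNorm (compCoeff K h (s - 1)) * (x ^ s / (s.factorial : ℝ)) /
            etaSum pauliNorm K h x : ℝ) : ℂ) •
          rotationMixture (compCoeff K h (s - 1)) (etaSum pauliNorm K h x) := by
  set η := etaSum pauliNorm K h x
  have hterm : ∀ s, Real.sqrt (1 + η ^ 2) •
      (pauliNorm (compCoeff K h (s - 1)) * (x ^ s / (s.factorial : ℝ)) / η) •
        rotationMixture (compCoeff K h (s - 1)) η =
      (pauliNorm (compCoeff K h (s - 1)) * (x ^ s / (s.factorial : ℝ)) / η) • (1 : Op n) +
        (x ^ s / (s.factorial : ℝ)) • compCoeff K h (s - 1) := fun s => by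
    rw [mul_div_assoc, mul_comm, mul_smul, smul_comm (Real.sqrt _), smul_comm (Real.sqrt _),
      pauliNorm_smul_sqrt_smul_rotationMixture (compCoeff_mem_skewAdjoint hh K _), smul_add,
      smul_smul, smul_smul, div_mul_cancel₀ _ hη]
  simp only [Complex.coe_smul, smul_sum, hterm, sum_add_distrib, ← sum_smul, ← sum_div,
    compensation]
  congr 1
  exact ((one_smul ℝ _).symm.trans (congrArg (· • (1 : Op n)) (div_self hη).symm))

end Compensation

end TrotterLCU

end

theorem mainTheorem4 {n L K : ℕ} (hK : K = 1 ∨ (Even K ∧ 0 < K))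
    (h : Fin L → Op n) (hh : ∀ l, (h l).IsHermitian) {x : ℝ} (hx : 0 < x) :
    -- the nested-commutator coefficients are the Taylor coefficients of `J_K`
    (∀ s, compCoeff K h s = iteratedDeriv s (derivRemainder K h) 0) ∧
    -- LCU formula over arbitrary unitaries, and the bound on its 1-norm
    IsLCUFormula (trotterRemainder K h x) (compensation K h x)
      (Real.sqrt (1 + etaSum oneNorm K h x ^ 2))
      ‖trotterRemainder K h x - compensation K h x‖ ∧
    Real.sqrt (1 + etaSum oneNorm K h x ^ 2) ≤
      Real.sqrt (1 + 4 * (stageCount K : ℝ) ^ 2 *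
        (∑ s ∈ Finset.Icc K (2 * K),
          alphaH oneNorm K h s * (x ^ (s + 1) / ((s + 1).factorial : ℝ))) ^ 2) ∧
    -- LCU formula over Pauli rotations, in explicit paired form, and the bound on its 1-norm
    IsLCUFormulaOver (pauliRotations n (Real.arctan (etaSum pauliNorm K h x)))
      (trotterRemainder K h x) (compensation K h x)
      (Real.sqrt (1 + etaSum pauliNorm K h x ^ 2))
      ‖trotterRemainder K h x - compensation K h x‖ ∧
    (etaSum pauliNorm K h x ≠ 0 →
      compensation K h x =
        (Real.sqrt (1 + etaSum pauliNorm K h x ^ 2) : ℂ) •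
          ∑ s ∈ Finset.Icc (K + 1) (2 * K + 1),
            ((pauliNorm (compCoeff K h (s - 1)) * (x ^ s / (s.factorial : ℝ)) /
                etaSum pauliNorm K h x : ℝ) : ℂ) •
              rotationMixture (compCoeff K h (s - 1)) (etaSum pauliNorm K h x)) ∧
    Real.sqrt (1 + etaSum pauliNorm K h x ^ 2) ≤
      Real.sqrt (1 + 4 * (stageCount K : ℝ) ^ 2 *
        (∑ s ∈ Finset.Icc K (2 * K),
          alphaH pauliNorm K h s * (x ^ (s + 1) / ((s + 1).factorial : ℝ))) ^ 2) ∧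
    -- the error bound
    ‖trotterRemainder K h x - compensation K h x‖ ≤
      4 * (stageCount K : ℝ) ^ 2 * alphaH (fun A => ‖A‖) K h K *
          (∑ s ∈ Finset.Icc K (2 * K),
            alphaH (fun A => ‖A‖) K h s *
              (x ^ (s + K + 2) /
                ((s.factorial : ℝ) * ((K + 1).factorial : ℝ) * ((s + K + 2 : ℕ) : ℝ)))) +
        2 * (stageCount K : ℝ) * (x ^ (2 * K + 2) / ((2 * K + 2).factorial : ℝ)) *
          alphaH (fun A => ‖A‖) K h (2 * K + 1) := by
  have hx0 := hx.le
  exact ⟨compCoeff_eq_iteratedDeriv hh K,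
    isLCUFormula_compensation hh hx0 _,
    sqrt_one_add_etaSum_sq_le oneNorm_nonneg (oneNorm_compCoeff_le hK hh) hx0,
    isLCUFormulaOver_pauliRotations hh hx0 _,
    compensation_eq_rotationMixture hh,
    sqrt_one_add_etaSum_sq_le pauliNorm_nonneg (seminorm_compCoeff_le (pauliSeminorm n) h hK) hx0,
    norm_trotterRemainder_sub_compensation_le hK hh hx0⟩
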